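/- Let $l^{(1)},l^{(2)},a_1>0$ with $l^{(1)}+l^{(2)}=1$. For $\varepsilon>0$ and $\tau\in[-\pi,\pi)$ write $\partial^{(\tau)}:=\frac{d}{dx}+i\tau$ and $\xi^{(\tau)}:=\exp(il^{(1)}\tau)$. **The operators $A_\varepsilon^{(\tau)}$ (Example (0): both the stiff and the soft component of the periodic chain are disconnected; the periodicity cell consists of one stiff and one soft edge).** In $H=L^2(0,l^{(2)})\oplus L^2(0,l^{(1)})$ (soft edge $\oplus$ stiff edge) let $A_\varepsilon^{(\tau)}$ be the operator $$A_\varepsilon^{(\tau)}(s,t)=\Bigl(-(\partial^{(\tau)})^2 s,\ -\tfrac{a_1^2}{\varepsilon^2}(\partial^{(\tau)})^2 t\Bigr)$$ whose domain consists of all $(s,t)$ with $s\in W^{2,2}(0,l^{(2)})$, $t\in W^{2,2}(0,l^{(1)})$ and $$s(0)=t(l^{(1)}),\quad s(l^{(2)})=t(0),\quad \partial^{(\tau)}s\big|_0=\tfrac{a_1^2}{\varepsilon^2}\,\partial^{(\tau)}t\big|_{l^{(1)}},\quad \partial^{(\tau)}s\big|_{l^{(2)}}=\tfrac{a_1^2}{\varepsilon^2}\,\partial^{(\tau)}t\big|_{0}.$$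 **The homogenised operator.** In $H_{\rm hom}=L^2(0,l^{(2)})\oplus\mathbb C$ let $$\operatorname{dom}\mathcal A_{\rm hom}^{(\tau)}=\Bigl\{(u,\beta):\ u\in W^{2,2}(0,l^{(2)}),\ u(0)=\overline{\xi^{(\tau)}}\,u(l^{(2)})=\beta/\sqrt{l^{(1)}}\Bigr\},$$ $$\mathcal A_{\rm hom}^{(\tau)}\binom{u}{\beta}=\begin{pmatrix}\bigl(\frac1i\frac{d}{dx}+\tau\bigr)^2u\\[2pt] -\frac1{\sqrt{l^{(1)}}}\bigl(\partial^{(\tau)}u\big|_0-\overline{\xi^{(\tau)}}\,\partial^{(\tau)}u\big|_{l^{(2)}}\bigr)\end{pmatrix}.$$ This operator does not depend on $\varepsilon$. **The operator $\Psi$.** Let $\varphi^{(\tau)}(x)=e^{i\tau(l^{(1)}-x)}/\sqrt{l^{(1)}}$ for $x\in(0,l^{(1)})$, and let $\Psi=\Psi^{(\tau)}:H\to H_{\rm hom}$, $\Psi(s,t)=\bigl(s,\int_0^{l^{(1)}}t\,\overline{\varphi^{(\tau)}}\,dx\bigr)$. **Theorem.** The operators $A_\varepsilon^{(\tau)}$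 and $\mathcal A_{\rm hom}^{(\tau)}$ are self-adjoint for all $\varepsilon>0$ and $\tau\in[-\pi,\pi)$, and $\Psi$ is a partial isometry onto $H_{\rm hom}$, that is, $\Psi\Psi^*=I$. For every compact $K\subset\mathbb C$ and every $\sigma>0$ there is a constant $C$, which depends only on $l^{(1)},l^{(2)},a_1,K,\sigma$, such that for all $\varepsilon>0$, all $\tau\in[-\pi,\pi)$ and all $z\in K_\sigma:=\{z\in K:\operatorname{dist}(z,\mathbb R)\ge\sigma\}$ both resolvents exist as bounded operators and $$\Bigl\|(A_\varepsilon^{(\tau)}-z)^{-1}-\Psi^*(\mathcal A_{\rm hom}^{(\tau)}-z)^{-1}\Psi\Bigr\|_{H\to H}\le C\varepsilon^2 .$$ -/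

import Mathlib

open MeasureTheory Set
open scoped ComplexConjugate InnerProductSpace

noncomputable section

namespace HighContrastChain

/-- The Hilbert space `L²(0, l)` of complex-valued functions. -/
abbrev L2 (l : ℝ) := Lp ℂ 2 (volume.restrict (Ioo (0 : ℝ) l))

/-- `f ∈ W^{2,2}(0, l)`, with derivatives `f₁ = f'` and `f₂ = f''`: on `[0, l]` the function `f`
is absolutely continuous with derivative `f₁`, the function `f₁` is absolutely continuous with
derivative `f₂`, and `f₂ ∈ L²(0, l)`. Thus `f` and `f₁` are the continuous representatives on
`[0, l]`, and `f 0`, `f l`, `f₁ 0`, `f₁ l` are the boundary values of the function and of its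
derivative. -/
structure IsW22 (l : ℝ) (f f₁ f₂ : ℝ → ℂ) : Prop where
  memLp : MemLp f₂ 2 (volume.restrict (Ioo (0 : ℝ) l))
  eq_f : ∀ x ∈ Icc (0 : ℝ) l, f x = f 0 + ∫ t in (0 : ℝ)..x, f₁ t
  eq_f₁ : ∀ x ∈ Icc (0 : ℝ) l, f₁ x = f₁ 0 + ∫ t in (0 : ℝ)..x, f₂ t

/-- The covariant derivative `∂^{(τ)} f = (d/dx + iτ) f` at `x`, where `f₁ = f'`. -/
def covDeriv (τ : ℝ) (f f₁ : ℝ → ℂ) (x : ℝ) : ℂ := f₁ x + Complex.I * τ * f x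

/-- `(d/dx + iτ)² f` at `x`, where `f₁ = f'` and `f₂ = f''`. -/
def covDerivTwo (τ : ℝ) (f f₁ f₂ : ℝ → ℂ) (x : ℝ) : ℂ :=
  f₂ x + 2 * Complex.I * τ * f₁ x - (τ : ℂ) ^ 2 * f x

/-- `u ∈ W^{2,2}(0, l)` and `v = -κ (d/dx + iτ)² u`, where `f` and `f₁` are the continuous
representatives of `u` and `u'`. -/
def EdgeRel (l τ κ : ℝ) (u v : L2 l) (f f₁ : ℝ → ℂ) : Prop :=
  ∃ f₂ : ℝ → ℂ, IsW22 l f f₁ f₂ ∧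
    u =ᵐ[volume.restrict (Ioo (0 : ℝ) l)] f ∧
    v =ᵐ[volume.restrict (Ioo (0 : ℝ) l)] fun x => -(κ : ℂ) * covDerivTwo τ f f₁ f₂ x

section SobolevFacts

variable {l τ κ : ℝ} {f f₁ f₂ g g₁ g₂ : ℝ → ℂ} {u v u' v' : L2 l}

theorem intervalIntegrable_of_memLp (h : MemLp f 2 (volume.restrict (Ioo (0 : ℝ) l)))
    {x : ℝ} (hx : x ∈ Icc (0 : ℝ) l) : IntervalIntegrable f volume 0 x := by
  have h1 : IntegrableOn f (Ioo (0 : ℝ) l) := h.integrable (by norm_num)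
  rw [intervalIntegrable_iff_integrableOn_Ioo_of_le hx.1]
  exact h1.mono_set (Ioo_subset_Ioo_right hx.2)

theorem IsW22.continuousOn_deriv (h : IsW22 l f f₁ f₂) : ContinuousOn f₁ (Icc 0 l) := by
  have h1 : IntegrableOn f₂ (Icc (0 : ℝ) l) := by
    rw [integrableOn_Icc_iff_integrableOn_Ioo]
    exact h.memLp.integrable (by norm_num)
  have h2 := intervalIntegral.continuousOn_primitive h1
  have h3 : ContinuousOn (fun x => f₁ 0 + ∫ t in Ioc (0 : ℝ) x, f₂ t) (Icc 0 l) :=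
    continuousOn_const.add h2
  refine h3.congr fun x hx => ?_
  rw [h.eq_f₁ x hx, intervalIntegral.integral_of_le hx.1]

theorem IsW22.intervalIntegrable_deriv (h : IsW22 l f f₁ f₂) {x : ℝ} (hx : x ∈ Icc (0 : ℝ) l) :
    IntervalIntegrable f₁ volume 0 x := by
  apply ContinuousOn.intervalIntegrable
  rw [uIcc_of_le hx.1]
  exact h.continuousOn_deriv.mono (Icc_subset_Icc_right hx.2)

theorem IsW22.continuousOn (h : IsW22 l f f₁ f₂) : ContinuousOn f (Icc 0 l) := by
  have h1 : IntegrableOn f₁ (Icc (0 : ℝ) l) :=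
    h.continuousOn_deriv.integrableOn_compact isCompact_Icc
  have h2 := intervalIntegral.continuousOn_primitive h1
  have h3 : ContinuousOn (fun x => f 0 + ∫ t in Ioc (0 : ℝ) x, f₁ t) (Icc 0 l) :=
    continuousOn_const.add h2
  refine h3.congr fun x hx => ?_
  rw [h.eq_f x hx, intervalIntegral.integral_of_le hx.1]

theorem IsW22.add (hf : IsW22 l f f₁ f₂) (hg : IsW22 l g g₁ g₂) :
    IsW22 l (f + g) (f₁ + g₁) (f₂ + g₂) where
  memLp := hf.memLp.add hg.memLp
  eq_f x hx := by
    simp only [Pi.add_apply]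
    rw [intervalIntegral.integral_add (hf.intervalIntegrable_deriv hx)
      (hg.intervalIntegrable_deriv hx), hf.eq_f x hx, hg.eq_f x hx]
    ring
  eq_f₁ x hx := by
    simp only [Pi.add_apply]
    rw [intervalIntegral.integral_add (intervalIntegrable_of_memLp hf.memLp hx)
      (intervalIntegrable_of_memLp hg.memLp hx), hf.eq_f₁ x hx, hg.eq_f₁ x hx]
    ring

theorem IsW22.smul (c : ℂ) (hf : IsW22 l f f₁ f₂) : IsW22 l (c • f) (c • f₁) (c • f₂) where
  memLp := hf.memLp.const_smul c
  eq_f x hx := by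
    simp only [Pi.smul_apply, smul_eq_mul]
    rw [intervalIntegral.integral_const_mul, hf.eq_f x hx]
    ring
  eq_f₁ x hx := by
    simp only [Pi.smul_apply, smul_eq_mul]
    rw [intervalIntegral.integral_const_mul, hf.eq_f₁ x hx]
    ring

theorem IsW22.zero : IsW22 l 0 0 0 where
  memLp := MemLp.zero
  eq_f x _ := by simp
  eq_f₁ x _ := by simp

/-- If a primitive of an integrable function vanishes on `[0, l]`, so does the function, a.e. -/
theorem ae_eq_zero_of_primitive_eq_zero (hl : 0 < l) (h : IntervalIntegrable f volume 0 l)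
    (h0 : ∀ x ∈ Icc (0 : ℝ) l, ∫ t in (0 : ℝ)..x, f t = 0) :
    f =ᵐ[volume.restrict (Ioo (0 : ℝ) l)] 0 := by
  have h1 := h.ae_hasDerivAt_integral
  refine (ae_restrict_iff' measurableSet_Ioo).2 ?_
  filter_upwards [h1] with x hx hxl
  have hx' : x ∈ uIcc 0 l := by
    rw [uIcc_of_le hl.le]
    exact Ioo_subset_Icc_self hxl
  have hd := hx hx' 0 (by simp)
  have hz : HasDerivAt (fun y => ∫ t in (0 : ℝ)..y, f t) (0 : ℂ) x := by
    refine (hasDerivAt_const x (0 : ℂ)).congr_of_eventuallyEq ?_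
    filter_upwards [isOpen_Ioo.mem_nhds hxl] with y hy
    exact h0 y (Ioo_subset_Icc_self hy)
  exact hd.unique hz

theorem IsW22.eq_zero (hl : 0 < l) (h : IsW22 l f f₁ f₂)
    (h0 : f =ᵐ[volume.restrict (Ioo (0 : ℝ) l)] 0) :
    EqOn f 0 (Icc 0 l) ∧ EqOn f₁ 0 (Icc 0 l) ∧ f₂ =ᵐ[volume.restrict (Ioo (0 : ℝ) l)] 0 := by
  have key : ∀ k : ℝ → ℂ, ContinuousOn k (Icc 0 l) →
      k =ᵐ[volume.restrict (Ioo (0 : ℝ) l)] 0 → EqOn k 0 (Icc 0 l) := by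
    intro k hk hk0
    refine Measure.eqOn_Icc_of_ae_eq (μ := volume) hl.ne ?_ hk continuousOn_const
    rwa [restrict_Ioo_eq_restrict_Icc] at hk0
  have hl0 : (0 : ℝ) ∈ Icc (0 : ℝ) l := ⟨le_rfl, hl.le⟩
  have hll : l ∈ Icc (0 : ℝ) l := ⟨hl.le, le_rfl⟩
  have hf := key f h.continuousOn h0
  have hf₁ : EqOn f₁ 0 (Icc 0 l) := by
    refine key f₁ h.continuousOn_deriv
      (ae_eq_zero_of_primitive_eq_zero hl (h.intervalIntegrable_deriv hll) fun x hx => ?_)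
    have := h.eq_f x hx
    rw [hf hx, hf hl0] at this
    simpa using this.symm
  refine ⟨hf, hf₁, ae_eq_zero_of_primitive_eq_zero hl
    (intervalIntegrable_of_memLp h.memLp hll) fun x hx => ?_⟩
  have := h.eq_f₁ x hx
  rw [hf₁ hx, hf₁ hl0] at this
  simpa using this.symm

theorem EdgeRel.add (h : EdgeRel l τ κ u v f f₁) (h' : EdgeRel l τ κ u' v' g g₁) :
    EdgeRel l τ κ (u + u') (v + v') (f + g) (f₁ + g₁) := by
  obtain ⟨f₂, hf, hu, hv⟩ := h
  obtain ⟨g₂, hg, hu', hv'⟩ := h'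
  refine ⟨f₂ + g₂, hf.add hg, (Lp.coeFn_add u u').trans (hu.add hu'), ?_⟩
  filter_upwards [Lp.coeFn_add v v', hv, hv'] with x h1 h2 h3
  rw [h1, Pi.add_apply, h2, h3]
  simp only [covDerivTwo, Pi.add_apply]
  ring

theorem EdgeRel.smul (c : ℂ) (h : EdgeRel l τ κ u v f f₁) :
    EdgeRel l τ κ (c • u) (c • v) (c • f) (c • f₁) := by
  obtain ⟨f₂, hf, hu, hv⟩ := h
  refine ⟨c • f₂, hf.smul c, (Lp.coeFn_smul c u).trans (hu.const_smul c), ?_⟩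
  filter_upwards [Lp.coeFn_smul c v, hv] with x h1 h2
  rw [h1, Pi.smul_apply, h2]
  simp only [covDerivTwo, Pi.smul_apply, smul_eq_mul]
  ring

theorem EdgeRel.zero : EdgeRel l τ κ 0 0 0 0 := by
  refine ⟨0, IsW22.zero, Lp.coeFn_zero _ _ _, ?_⟩
  filter_upwards [Lp.coeFn_zero ℂ 2 (volume.restrict (Ioo (0 : ℝ) l))] with x h1
  rw [h1]
  simp [covDerivTwo]

/-- The boundary values and the image under the differential expression are determined by the
function. -/
theorem EdgeRel.eq_zero (hl : 0 < l) (h : EdgeRel l τ κ 0 v f f₁) :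
    v = 0 ∧ EqOn f 0 (Icc 0 l) ∧ EqOn f₁ 0 (Icc 0 l) := by
  obtain ⟨f₂, hf, hu, hv⟩ := h
  have h0 : f =ᵐ[volume.restrict (Ioo (0 : ℝ) l)] 0 :=
    hu.symm.trans (Lp.coeFn_zero _ _ _)
  obtain ⟨e, e₁, e₂⟩ := hf.eq_zero hl h0
  refine ⟨?_, e, e₁⟩
  rw [Lp.eq_zero_iff_ae_eq_zero]
  filter_upwards [hv, e₂, ae_restrict_mem measurableSet_Ioo] with x h1 h2 h3
  have h3' := Ioo_subset_Icc_self h3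
  rw [h1, covDerivTwo, h2, e h3', e₁ h3']
  simp

end SobolevFacts

/-- The state space `H = H_soft ⊕ H_stiff = L²(0, l₂) ⊕ L²(0, l₁)` of the graph with one soft
edge of length `l₂` and one stiff edge of length `l₁`. The component `fst` is the soft one. -/
abbrev H (l₁ l₂ : ℝ) := WithLp 2 (L2 l₂ × L2 l₁)

/-- The homogenised state space `H_hom = H_soft ⊕ ℂ = L²(0, l₂) ⊕ ℂ`. -/
abbrev Hhom (l₂ : ℝ) := WithLp 2 (L2 l₂ × ℂ)

/-- The graph of the fibre operator `A_ε^{(τ)}`. The metric graph has two vertices `V₁`, `V₂`. The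
soft edge `[0, l₂]` goes from `V₁` (left endpoint) to `V₂` (right endpoint), the stiff edge
`[0, l₁]` goes from `V₂` (left endpoint) to `V₁` (right endpoint). The operator acts as
`-(d/dx + iτ)²` on the soft edge and as `-(a₁²/ε²)(d/dx + iτ)²` on the stiff edge. At both vertices
the function is continuous and the inward normal co-derivatives add up to zero. Here `s`, `s₁` are
the representatives of the soft component and of its derivative, and `t`, `t₁` those of the stiff
component. -/
def fibreGraph (l₁ l₂ a₁ ε τ : ℝ) : Submodule ℂ (H l₁ l₂ × H l₁ l₂) where
  carrier := {p | ∃ s s₁ t t₁ : ℝ → ℂ,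
    EdgeRel l₂ τ 1 p.1.fst p.2.fst s s₁ ∧
    EdgeRel l₁ τ (a₁ ^ 2 / ε ^ 2) p.1.snd p.2.snd t t₁ ∧
    s 0 = t l₁ ∧
    s l₂ = t 0 ∧
    covDeriv τ s s₁ 0 - ((a₁ ^ 2 / ε ^ 2 : ℝ) : ℂ) * covDeriv τ t t₁ l₁ = 0 ∧
    -covDeriv τ s s₁ l₂ + ((a₁ ^ 2 / ε ^ 2 : ℝ) : ℂ) * covDeriv τ t t₁ 0 = 0}
  add_mem' := by
    rintro p q ⟨s, s₁, t, t₁, h1, h2, h3, h4, h5, h6⟩ ⟨s', s₁', t', t₁', k1, k2, k3, k4, k5, k6⟩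
    refine ⟨s + s', s₁ + s₁', t + t', t₁ + t₁', h1.add k1, h2.add k2, ?_, ?_, ?_, ?_⟩
    · simp [h3, k3]
    · simp [h4, k4]
    · simp only [covDeriv, Pi.add_apply] at *
      linear_combination h5 + k5
    · simp only [covDeriv, Pi.add_apply] at *
      linear_combination h6 + k6
  zero_mem' := by
    refine ⟨0, 0, 0, 0, EdgeRel.zero, EdgeRel.zero, ?_, ?_, ?_, ?_⟩ <;> simp [covDeriv]
  smul_mem' := by
    rintro c p ⟨s, s₁, t, t₁, h1, h2, h3, h4, h5, h6⟩
    refine ⟨c • s, c • s₁, c • t, c • t₁, h1.smul c, h2.smul c, ?_, ?_, ?_, ?_⟩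
    · simp [h3]
    · simp [h4]
    · simp only [covDeriv, Pi.smul_apply, smul_eq_mul] at *
      linear_combination c * h5
    · simp only [covDeriv, Pi.smul_apply, smul_eq_mul] at *
      linear_combination c * h6

/-- The fibre operator `A_ε^{(τ)}`, an unbounded operator in `H`. -/
def fibreOp (l₁ l₂ a₁ ε τ : ℝ) : H l₁ l₂ →ₗ.[ℂ] H l₁ l₂ :=
  (fibreGraph l₁ l₂ a₁ ε τ).toLinearPMap

theorem fibreOp_graph {l₁ l₂ : ℝ} (hl₁ : 0 < l₁) (hl₂ : 0 < l₂) (a₁ ε τ : ℝ) :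
    (fibreOp l₁ l₂ a₁ ε τ).graph = fibreGraph l₁ l₂ a₁ ε τ := by
  refine Submodule.toLinearPMap_graph_eq _ ?_
  rintro ⟨p, q⟩ ⟨s, s₁, t, t₁, h1, h2, -⟩ hp
  simp only at hp h1 h2
  subst hp
  have e1 := (EdgeRel.eq_zero hl₂ h1).1
  have e2 := (EdgeRel.eq_zero hl₁ h2).1
  exact WithLp.ofLp_injective 2 (Prod.ext e1 e2)

/-- `ξ^{(τ)} = exp(i l₁ τ)`. -/
def xi (l₁ τ : ℝ) : ℂ := Complex.exp (Complex.I * l₁ * τ)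

/-- The graph of the homogenised operator `𝒜_hom^{(τ)}`: its domain consists of the `(u, β)` with
`u ∈ W^{2,2}(0, l₂)` and `u(0) = conj ξ · u(l₂) = β/√l₁`, and `(u, β)` is mapped to
`(-(d/dx + iτ)² u, -(1/√l₁) (∂u(0) - conj ξ · ∂u(l₂)))` with `∂ = d/dx + iτ`. -/
def homGraph (l₁ l₂ τ : ℝ) : Submodule ℂ (Hhom l₂ × Hhom l₂) where
  carrier := {p | ∃ f f₁ : ℝ → ℂ,
    EdgeRel l₂ τ 1 p.1.fst p.2.fst f f₁ ∧
    f 0 = conj (xi l₁ τ) * f l₂ ∧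
    f 0 = p.1.snd / (Real.sqrt l₁ : ℂ) ∧
    p.2.snd = -(1 / (Real.sqrt l₁ : ℂ)) *
      (covDeriv τ f f₁ 0 - conj (xi l₁ τ) * covDeriv τ f f₁ l₂)}
  add_mem' := by
    rintro p q ⟨f, f₁, h1, h2, h3, h4⟩ ⟨g, g₁, k1, k2, k3, k4⟩
    refine ⟨f + g, f₁ + g₁, h1.add k1, ?_, ?_, ?_⟩
    · simp only [Pi.add_apply]
      linear_combination h2 + k2
    · simp only [Pi.add_apply, Prod.fst_add, WithLp.add_snd]
      linear_combination h3 + k3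
    · simp only [covDeriv, Pi.add_apply, Prod.snd_add, WithLp.add_snd] at *
      linear_combination h4 + k4
  zero_mem' := by
    refine ⟨0, 0, EdgeRel.zero, ?_, ?_, ?_⟩ <;> simp [covDeriv]
  smul_mem' := by
    rintro c p ⟨f, f₁, h1, h2, h3, h4⟩
    refine ⟨c • f, c • f₁, h1.smul c, ?_, ?_, ?_⟩
    · simp only [Pi.smul_apply, smul_eq_mul]
      linear_combination c * h2
    · simp only [Pi.smul_apply, smul_eq_mul, Prod.smul_fst, WithLp.smul_snd]
      linear_combination c * h3
    · simp only [covDeriv, Pi.smul_apply, smul_eq_mul, Prod.smul_snd, WithLp.smul_snd] at *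
      linear_combination c * h4

/-- The homogenised operator `𝒜_hom^{(τ)}`, an unbounded operator in `H_hom`. -/
def homOp (l₁ l₂ τ : ℝ) : Hhom l₂ →ₗ.[ℂ] Hhom l₂ := (homGraph l₁ l₂ τ).toLinearPMap

theorem homOp_graph {l₂ : ℝ} (l₁ : ℝ) (hl₂ : 0 < l₂) (τ : ℝ) :
    (homOp l₁ l₂ τ).graph = homGraph l₁ l₂ τ := by
  refine Submodule.toLinearPMap_graph_eq _ ?_
  rintro ⟨p, q⟩ ⟨f, f₁, h1, -, -, h4⟩ hp
  simp only at hp h1 h4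
  subst hp
  obtain ⟨e1, e2, e3⟩ := EdgeRel.eq_zero hl₂ h1
  have hl0 : (0 : ℝ) ∈ Icc (0 : ℝ) l₂ := ⟨le_rfl, hl₂.le⟩
  have hll : l₂ ∈ Icc (0 : ℝ) l₂ := ⟨hl₂.le, le_rfl⟩
  refine WithLp.ofLp_injective 2 (Prod.ext e1 ?_)
  change q.snd = 0
  rw [h4]
  simp [covDeriv, e2 hl0, e2 hll, e3 hl0, e3 hll]

/-- The normalised stiff mode `x ↦ exp(iτ(l₁ - x))/√l₁` as a function. It spans the kernel of
`d/dx + iτ` on the stiff edge and is positive at the right endpoint. -/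
def stiffModeFun (l₁ τ x : ℝ) : ℂ :=
  Complex.exp (Complex.I * τ * ((l₁ : ℂ) - x)) / (Real.sqrt l₁ : ℂ)

theorem memLp_stiffModeFun (l₁ τ : ℝ) :
    MemLp (stiffModeFun l₁ τ) 2 (volume.restrict (Ioo (0 : ℝ) l₁)) := by
  have hc : Continuous (stiffModeFun l₁ τ) := by
    unfold stiffModeFun
    fun_prop
  refine MemLp.of_bound hc.aestronglyMeasurable (1 / Real.sqrt l₁) (ae_of_all _ fun x => ?_)
  have h : Complex.I * τ * ((l₁ : ℂ) - x) = ((τ * (l₁ - x) : ℝ) : ℂ) * Complex.I := by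
    push_cast
    ring
  rw [stiffModeFun, norm_div, h, Complex.norm_exp_ofReal_mul_I, Complex.norm_real,
    Real.norm_of_nonneg (Real.sqrt_nonneg _)]

/-- The normalised stiff mode as an element of `L²(0, l₁)`. -/
def stiffMode (l₁ τ : ℝ) : L2 l₁ := (memLp_stiffModeFun l₁ τ).toLp _

/-- The operator `Ψ : H → H_hom`, `(u_soft, u_stiff) ↦ (u_soft, ⟨u_stiff, stiff mode⟩)`. In Mathlib
the inner product is conjugate-linear in its first argument, so the second component is
`∫ u_stiff · conj (stiff mode)`. -/
def Psi (l₁ l₂ τ : ℝ) : H l₁ l₂ →L[ℂ] Hhom l₂ :=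
  ((WithLp.prodContinuousLinearEquiv 2 ℂ (L2 l₂) ℂ).symm : L2 l₂ × ℂ →L[ℂ] Hhom l₂) ∘L
    ((ContinuousLinearMap.id ℂ (L2 l₂)).prodMap (innerSL ℂ (stiffMode l₁ τ))) ∘L
      ((WithLp.prodContinuousLinearEquiv 2 ℂ (L2 l₂) (L2 l₁)) : H l₁ l₂ →L[ℂ] L2 l₂ × L2 l₁)

/-- `R = (A - z)⁻¹`: the bounded, everywhere defined operator `R` is a two-sided inverse of
`A - z : dom A → E`. -/
def IsResolventAt {E : Type*} [NormedAddCommGroup E] [NormedSpace ℂ E]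
    (A : E →ₗ.[ℂ] E) (z : ℂ) (R : E →L[ℂ] E) : Prop :=
  (∀ f : E, ∃ u : A.domain, (u : E) = R f ∧ A u - z • (u : E) = f) ∧
    ∀ u : A.domain, R (A u - z • (u : E)) = u

end HighContrastChain

end

/-!
Both operators are restrictions of `-κ (d/dx + iτ)²` by boundary conditions, with `κ = 1` on the
soft edge and `κ = a₁²/ε²` on the stiff edge.

Self-adjointness and existence of the resolvents. Green's identity on an edge (`EdgeRel.green`),
which is the product rule for absolutely continuous functions, makes both operators symmetric. For
nonreal `z` the equation on an edge can be solved with arbitrary initial values, since the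
differential expression factors into two first-order ones (`exists_edgeRel_sub_smul_eq`). What
remains is to match the vertex conditions by a combination of homogeneous solutions. This is a
square linear system, and a symmetric operator has no nonreal eigenvalues, so it is uniquely
solvable. Hence `A - z` is surjective for all nonreal `z`, which gives self-adjointness and the
resolvent (`isSelfAdjoint_of_isFormalAdjoint`, `exists_isResolventAt`).

The resolvent estimate. Let `w = (s, t)` be `(A_ε - z)⁻¹ F` and `p = (𝒜_hom - z)⁻¹ Ψ F`. The graph
norm of `w` is bounded by a multiple of `‖F‖`, hence so is the boundary value of
`∂s = s' + iτ s`. By the vertex condition and the differential equation on the stiff edge,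
`(a₁²/ε²) ∂t` is then bounded on the whole stiff edge, so that `∂t` is uniformly of order `ε²`, and
so is the deviation of `t` from its projection onto the stiff mode, the kernel of `∂`
(`norm_sub_stiffMode_le_of_mem_fibreGraph`). This controls the part of `w` orthogonal to the range
of `Ψ*`. For the other part, `Ψ w - p` is paired with `(𝒜_hom - conj z) q`. By Green's identities
all boundary terms cancel, except the products of the deviation of `t` at the two vertices with the
boundary values of `∂q` (`inner_Psi_sub_inner_Psi`). Choosing `q` such that
`(𝒜_hom - conj z) q = Ψ w - p` gives `‖Ψ w - p‖ = O(ε²) ‖F‖`. All constants depend only on the edge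
lengths, on `a₁`, and on bounds for `|z|` and `1/|Im z|`; in particular no smallness of `ε` is
needed.
-/

namespace HighContrastChain

/-! ### Absolutely continuous functions -/

/-- On `[0, l]` the function `f` is absolutely continuous with the integrable derivative `f₁`. -/
structure IsPrimitiveOn (l : ℝ) (f f₁ : ℝ → ℂ) : Prop where
  integrable : IntervalIntegrable f₁ volume 0 l
  eq_add_integral : ∀ x ∈ Icc (0 : ℝ) l, f x = f 0 + ∫ t in (0 : ℝ)..x, f₁ t

section Primitives

variable {l : ℝ} {f f₁ g g₁ : ℝ → ℂ}

theorem IsPrimitiveOn.intervalIntegrable (hf : IsPrimitiveOn l f f₁) {x y : ℝ}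
    (hx : x ∈ Icc (0 : ℝ) l) (hy : y ∈ Icc (0 : ℝ) l) : IntervalIntegrable f₁ volume x y := by
  refine hf.integrable.mono_set ?_
  rw [uIcc_of_le (hx.1.trans hx.2)]
  exact uIcc_subset_Icc hx hy

theorem IsPrimitiveOn.sub_eq_integral (hf : IsPrimitiveOn l f f₁) {x y : ℝ}
    (hx : x ∈ Icc (0 : ℝ) l) (hy : y ∈ Icc (0 : ℝ) l) : f y - f x = ∫ t in x..y, f₁ t := by
  have h0 : (0 : ℝ) ∈ Icc (0 : ℝ) l := ⟨le_rfl, hx.1.trans hx.2⟩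
  rw [hf.eq_add_integral x hx, hf.eq_add_integral y hy,
    ← intervalIntegral.integral_interval_sub_left (hf.intervalIntegrable h0 hy)
      (hf.intervalIntegrable h0 hx)]
  ring

theorem IsPrimitiveOn.continuousOn (hf : IsPrimitiveOn l f f₁) : ContinuousOn f (Icc 0 l) := by
  rcases lt_or_ge l 0 with hl | hl
  · simp [Icc_eq_empty_of_lt hl]
  have h1 : ContinuousOn (fun x => f 0 + ∫ t in (0 : ℝ)..x, f₁ t) (Icc 0 l) := by
    rw [← uIcc_of_le hl]
    refine continuousOn_const.add
      (intervalIntegral.continuousOn_primitive_interval' hf.integrable (by simp))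
  exact h1.congr hf.eq_add_integral

theorem IsPrimitiveOn.add (hf : IsPrimitiveOn l f f₁) (hg : IsPrimitiveOn l g g₁) :
    IsPrimitiveOn l (fun x => f x + g x) (fun x => f₁ x + g₁ x) where
  integrable := hf.integrable.add hg.integrable
  eq_add_integral x hx := by
    have h0 : (0 : ℝ) ∈ Icc (0 : ℝ) l := ⟨le_rfl, hx.1.trans hx.2⟩
    rw [intervalIntegral.integral_add (hf.intervalIntegrable h0 hx)
      (hg.intervalIntegrable h0 hx), hf.eq_add_integral x hx, hg.eq_add_integral x hx]
    ring

theorem IsPrimitiveOn.const_mul (hf : IsPrimitiveOn l f f₁) (c : ℂ) :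
    IsPrimitiveOn l (fun x => c * f x) (fun x => c * f₁ x) where
  integrable := hf.integrable.const_mul c
  eq_add_integral x hx := by
    rw [intervalIntegral.integral_const_mul, hf.eq_add_integral x hx]
    ring

theorem IsPrimitiveOn.conj (hf : IsPrimitiveOn l f f₁) :
    IsPrimitiveOn l (fun x => conj (f x)) (fun x => conj (f₁ x)) where
  integrable := by
    have := hf.integrable
    rw [intervalIntegrable_iff] at this ⊢
    exact (RCLike.conjCLE (K := ℂ)).toContinuousLinearMap.integrable_comp this
  eq_add_integral x hx := by
    rw [hf.eq_add_integral x hx, map_add]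
    congr 1
    rcases le_total 0 x with h0 | h0
    · rw [intervalIntegral.integral_of_le h0, intervalIntegral.integral_of_le h0, integral_conj]
    · rw [intervalIntegral.integral_of_ge h0, intervalIntegral.integral_of_ge h0, integral_conj,
        map_neg]

theorem IsPrimitiveOn.of_hasDerivAt (hf : ∀ x, HasDerivAt f (f₁ x) x) (hc : Continuous f₁) :
    IsPrimitiveOn l f f₁ where
  integrable := hc.intervalIntegrable _ _
  eq_add_integral x _ := by
    rw [intervalIntegral.integral_eq_sub_of_hasDerivAt (fun y _ => hf y)
      (hc.intervalIntegrable _ _)]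
    ring

/-- Absolute continuity on an interval depends only on the values on this interval. -/
theorem absolutelyContinuousOnInterval_congr {X : Type*} [PseudoMetricSpace X] {a b : ℝ}
    {F G : ℝ → X} (hF : AbsolutelyContinuousOnInterval F a b) (h : EqOn F G (uIcc a b)) :
    AbsolutelyContinuousOnInterval G a b := by
  rw [absolutelyContinuousOnInterval_iff] at hF ⊢
  intro ε hε
  obtain ⟨δ, hδ, hd⟩ := hF ε hε
  refine ⟨δ, hδ, fun E hE hEδ => ?_⟩
  have := hd E hE hEδ
  rwa [Finset.sum_congr rfl fun i hi => by rw [h (hE.1 i hi).1, h (hE.1 i hi).2]] at this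

/-- The primitive of a complex-valued integrable function is absolutely continuous. -/
theorem absolutelyContinuousOnInterval_integral {a b : ℝ}
    (h : IntervalIntegrable f volume a b) :
    AbsolutelyContinuousOnInterval (fun x => ∫ t in a..x, f t) a b := by
  have hre : IntervalIntegrable (fun t => (f t).re) volume a b := by
    rw [intervalIntegrable_iff] at h ⊢
    exact h.re
  have him : IntervalIntegrable (fun t => (f t).im) volume a b := by
    rw [intervalIntegrable_iff] at h ⊢
    exact h.im
  have hconst (c : ℂ) : AbsolutelyContinuousOnInterval (fun _ : ℝ => c) a b :=
    (LipschitzWith.const c).lipschitzOnWith.absolutelyContinuousOnInterval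
  have h1 := ((hre.absolutelyContinuousOnInterval_intervalIntegral left_mem_uIcc).smul
    (hconst 1)).add ((him.absolutelyContinuousOnInterval_intervalIntegral left_mem_uIcc).smul
    (hconst Complex.I))
  have key : ∀ x ∈ uIcc a b, (∫ t in a..x, f t) =
      (∫ t in a..x, (f t).re) • (1 : ℂ) + (∫ t in a..x, (f t).im) • Complex.I := by
    intro x hx
    have hi : IntervalIntegrable f volume a x := h.mono_set (uIcc_subset_uIcc_left hx)
    have e1 := Complex.reCLM.intervalIntegral_comp_comm hi
    have e2 := Complex.imCLM.intervalIntegral_comp_comm hi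
    simp only [Complex.reCLM_apply, Complex.imCLM_apply] at e1 e2
    rw [e1, e2]
    simp [Complex.re_add_im]
  exact absolutelyContinuousOnInterval_congr h1 fun x hx => (key x hx).symm

/-- The product rule for absolutely continuous functions. -/
theorem IsPrimitiveOn.mul (hl : 0 ≤ l) (hf : IsPrimitiveOn l f f₁) (hg : IsPrimitiveOn l g g₁) :
    IsPrimitiveOn l (fun x => f x * g x) (fun x => f₁ x * g x + f x * g₁ x) := by
  have hI : uIcc 0 l = Icc 0 l := uIcc_of_le hl
  have hint : IntervalIntegrable (fun x => f₁ x * g x + f x * g₁ x) volume 0 l :=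
    (hf.integrable.mul_continuousOn (hI ▸ hg.continuousOn)).add
      (hg.integrable.continuousOn_mul (hI ▸ hf.continuousOn))
  have hconst (c : ℂ) : AbsolutelyContinuousOnInterval (fun _ : ℝ => c) 0 l :=
    (LipschitzWith.const c).lipschitzOnWith.absolutelyContinuousOnInterval
  have hF := (hconst (f 0)).add (absolutelyContinuousOnInterval_integral hf.integrable)
  have hG := (hconst (g 0)).add (absolutelyContinuousOnInterval_integral hg.integrable)
  -- The difference of the product and of the primitive of its formal derivative has derivative
  -- zero almost everywhere, hence is constant.
  have hD := (hF.smul hG).sub (absolutelyContinuousOnInterval_integral hint)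
  obtain ⟨C, hC⟩ := hD.const_of_ae_hasDerivAt_zero (by
    filter_upwards [hf.integrable.ae_hasDerivAt_integral, hg.integrable.ae_hasDerivAt_integral,
      hint.ae_hasDerivAt_integral] with x h1 h2 h3 hx
    have hx' : x ∈ Icc 0 l := hI ▸ hx
    have e := (((h1 hx 0 left_mem_uIcc).const_add (f 0)).mul
      ((h2 hx 0 left_mem_uIcc).const_add (g 0))).sub (h3 hx 0 left_mem_uIcc)
    refine HasDerivAt.congr_deriv e ?_
    rw [← hf.eq_add_integral x hx', ← hg.eq_add_integral x hx']
    ring)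
  refine ⟨hint, fun x hx => ?_⟩
  have e1 : (f 0 + ∫ t in (0 : ℝ)..x, f₁ t) * (g 0 + ∫ t in (0 : ℝ)..x, g₁ t) -
    (∫ t in (0 : ℝ)..x, (f₁ t * g t + f t * g₁ t)) = C := hC x (hI ▸ hx)
  have e2 : (f 0 + ∫ t in (0 : ℝ)..0, f₁ t) * (g 0 + ∫ t in (0 : ℝ)..0, g₁ t) -
    (∫ t in (0 : ℝ)..0, (f₁ t * g t + f t * g₁ t)) = C := hC 0 left_mem_uIcc
  simp only [intervalIntegral.integral_same, add_zero, sub_zero] at e2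
  rw [hf.eq_add_integral x hx, hg.eq_add_integral x hx]
  linear_combination e1 - e2

end Primitives

/-! ### Linear equations with constant coefficients -/

theorem IsPrimitiveOn.integral {l : ℝ} {r : ℝ → ℂ} (h : IntervalIntegrable r volume 0 l) (c : ℂ) :
    IsPrimitiveOn l (fun x => c + ∫ t in (0 : ℝ)..x, r t) r :=
  ⟨h, fun x _ => by simp⟩

theorem IsPrimitiveOn.exp (l : ℝ) (μ : ℂ) :
    IsPrimitiveOn l (fun x => Complex.exp (μ * x)) (fun x => μ * Complex.exp (μ * x)) := by
  refine IsPrimitiveOn.of_hasDerivAt (fun x => ?_) (by fun_prop)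
  have h : HasDerivAt (fun y : ℝ => μ * (y : ℂ)) μ x := by
    simpa using (Complex.ofRealCLM.hasDerivAt (x := x)).const_mul μ
  simpa [mul_comm] using h.cexp

/-- The initial value problem `y' = μ y + r`, `y(0) = c` has a solution, by variation of the
constant. -/
theorem exists_isPrimitiveOn_linear {l : ℝ} (hl : 0 ≤ l) {r : ℝ → ℂ}
    (hr : IntervalIntegrable r volume 0 l) (μ c : ℂ) :
    ∃ y : ℝ → ℂ, IsPrimitiveOn l y (fun x => μ * y x + r x) ∧ y 0 = c := by
  have h1 : IntervalIntegrable (fun x => Complex.exp (-μ * x) * r x) volume 0 l :=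
    hr.continuousOn_mul (by fun_prop)
  have h2 := (IsPrimitiveOn.exp l μ).mul hl (IsPrimitiveOn.integral h1 c)
  refine ⟨fun x => Complex.exp (μ * x) *
    (c + ∫ t in (0 : ℝ)..x, Complex.exp (-μ * t) * r t), ?_, ?_⟩
  · convert h2 using 2 with x
    have : Complex.exp (μ * x) * Complex.exp (-μ * x) = 1 := by
      rw [← Complex.exp_add]; simp
    linear_combination (-r x) * this
  · simp

/-! ### The differential expression on one edge -/

section Edges

variable {l τ κ : ℝ} {f f₁ f₂ g g₁ g₂ : ℝ → ℂ} {u v u' v' : L2 l}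

theorem IsW22.isPrimitiveOn_deriv (hl : 0 ≤ l) (h : IsW22 l f f₁ f₂) : IsPrimitiveOn l f₁ f₂ :=
  ⟨intervalIntegrable_of_memLp h.memLp ⟨hl, le_rfl⟩, h.eq_f₁⟩

theorem IsW22.isPrimitiveOn (hl : 0 ≤ l) (h : IsW22 l f f₁ f₂) : IsPrimitiveOn l f f₁ :=
  ⟨h.intervalIntegrable_deriv ⟨hl, le_rfl⟩, h.eq_f⟩

theorem memLp_of_continuousOn (hf : ContinuousOn f (Icc 0 l)) :
    MemLp f 2 (volume.restrict (Ioo (0 : ℝ) l)) := by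
  obtain ⟨C, hC⟩ := isCompact_Icc.exists_bound_of_continuousOn hf
  refine MemLp.of_bound ((hf.mono Ioo_subset_Icc_self).aestronglyMeasurable measurableSet_Ioo) C ?_
  filter_upwards [ae_restrict_mem measurableSet_Ioo] with x hx using hC x (Ioo_subset_Icc_self hx)

theorem IsW22.memLp_covDerivTwo (h : IsW22 l f f₁ f₂) :
    MemLp (covDerivTwo τ f f₁ f₂) 2 (volume.restrict (Ioo (0 : ℝ) l)) :=
  (h.memLp.add ((memLp_of_continuousOn h.continuousOn_deriv).const_mul _)).sub
    ((memLp_of_continuousOn h.continuousOn).const_mul _)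

/-- Every `f ∈ W^{2,2}(0, l)` gives a pair of `L²` functions in the edge relation. -/
theorem IsW22.exists_edgeRel (τ κ : ℝ) (h : IsW22 l f f₁ f₂) :
    ∃ u v : L2 l, EdgeRel l τ κ u v f f₁ ∧
      v =ᵐ[volume.restrict (Ioo (0 : ℝ) l)] fun x => -(κ : ℂ) * covDerivTwo τ f f₁ f₂ x := by
  have hu := memLp_of_continuousOn h.continuousOn
  have hv := (h.memLp_covDerivTwo (τ := τ)).const_mul (-(κ : ℂ))
  exact ⟨hu.toLp _, hv.toLp _, ⟨f₂, h, hu.coeFn_toLp, hv.coeFn_toLp⟩, hv.coeFn_toLp⟩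

/-- The equation `-κ (d/dx + iτ)² f - z f = g` on one edge has a solution with any prescribed
values of `f` and `f'` at the left endpoint. -/
theorem exists_edgeRel_sub_smul_eq (hl : 0 ≤ l) (hκ : κ ≠ 0) (τ : ℝ) (z a b : ℂ) (w : L2 l) :
    ∃ (u v : L2 l) (f f₁ : ℝ → ℂ), EdgeRel l τ κ u v f f₁ ∧ v - z • u = w ∧ f 0 = a ∧ f₁ 0 = b := by
  have hκ' : (κ : ℂ) ≠ 0 := by exact_mod_cast hκ
  -- With `k² = -z/κ` the differential expression factors as `(∂ - k)(∂ + k)` where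
  -- `∂ = d/dx + iτ`, and both factors are of first order.
  obtain ⟨k, hk⟩ := IsAlgClosed.exists_pow_nat_eq (-z / (κ : ℂ)) two_pos
  have hr : MemLp (fun x => -(1 / (κ : ℂ)) * w x) 2 (volume.restrict (Ioo (0 : ℝ) l)) :=
    (Lp.memLp w).const_mul _
  obtain ⟨y, hy, hy0⟩ := exists_isPrimitiveOn_linear hl
    (intervalIntegrable_of_memLp hr ⟨hl, le_rfl⟩) (k - Complex.I * τ)
    (b - (-k - Complex.I * τ) * a)
  have hy' : IntervalIntegrable y volume 0 l := by
    refine ContinuousOn.intervalIntegrable ?_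
    rw [uIcc_of_le hl]
    exact hy.continuousOn
  obtain ⟨f, hf, hf0⟩ := exists_isPrimitiveOn_linear hl hy' (-k - Complex.I * τ) a
  have hf₁ := (hf.const_mul (-k - Complex.I * τ)).add hy
  have hW : IsW22 l f (fun x => (-k - Complex.I * τ) * f x + y x)
      (fun x => (-k - Complex.I * τ) * ((-k - Complex.I * τ) * f x + y x) +
        ((k - Complex.I * τ) * y x + -(1 / (κ : ℂ)) * w x)) := by
    refine ⟨?_, hf.eq_add_integral, hf₁.eq_add_integral⟩
    exact ((memLp_of_continuousOn hf₁.continuousOn).const_mul _).add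
      (((memLp_of_continuousOn hy.continuousOn).const_mul _).add hr)
  obtain ⟨u, v, huv, hv⟩ := hW.exists_edgeRel τ κ
  refine ⟨u, v, _, _, huv, ?_, hf0, by simp only [hf0, hy0]; ring⟩
  obtain ⟨-, -, hu, -⟩ := huv
  refine Lp.ext ?_
  filter_upwards [Lp.coeFn_sub v (z • u), Lp.coeFn_smul z u, hu, hv] with x h1 h2 h3 h4
  rw [h1, Pi.sub_apply, h2, Pi.smul_apply, h3, h4, covDerivTwo]
  have hz : z = -(κ : ℂ) * k ^ 2 := by rw [hk]; field_simp
  rw [hz]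
  field_simp
  ring_nf
  simp only [Complex.I_sq]
  ring

/-- The Wronskian-type boundary form of `f` and `g` at `x`. -/
def bdryForm (τ : ℝ) (f f₁ g g₁ : ℝ → ℂ) (x : ℝ) : ℂ :=
  conj (covDeriv τ f f₁ x) * g x - conj (f x) * covDeriv τ g g₁ x

theorem isPrimitiveOn_bdryForm (hl : 0 ≤ l) (hf : IsW22 l f f₁ f₂) (hg : IsW22 l g g₁ g₂) :
    IsPrimitiveOn l (bdryForm τ f f₁ g g₁)
      (fun x => conj (covDerivTwo τ f f₁ f₂ x) * g x - conj (f x) * covDerivTwo τ g g₁ g₂ x) := by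
  have h1 := (((hf.isPrimitiveOn_deriv hl).add
    ((hf.isPrimitiveOn hl).const_mul (Complex.I * τ))).conj.mul hl (hg.isPrimitiveOn hl))
  have h2 := ((hf.isPrimitiveOn hl).conj.mul hl ((hg.isPrimitiveOn_deriv hl).add
    ((hg.isPrimitiveOn hl).const_mul (Complex.I * τ)))).const_mul (-1)
  convert h1.add h2 using 2 with x x
  · simp only [bdryForm, covDeriv]
    ring
  · simp only [covDerivTwo, map_add, map_sub, map_mul, map_pow, Complex.conj_I, Complex.conj_ofReal,
      map_ofNat]
    ring

/-- Green's identity on one edge. -/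
theorem EdgeRel.green (hl : 0 ≤ l) (h : EdgeRel l τ κ u v f f₁) (h' : EdgeRel l τ κ u' v' g g₁) :
    ⟪u, v'⟫_ℂ - ⟪v, u'⟫_ℂ = κ * (bdryForm τ f f₁ g g₁ l - bdryForm τ f f₁ g g₁ 0) := by
  obtain ⟨f₂, hf, hu, hv⟩ := h
  obtain ⟨g₂, hg, hu', hv'⟩ := h'
  have hP := isPrimitiveOn_bdryForm (τ := τ) hl hf hg
  rw [hP.sub_eq_integral ⟨le_rfl, hl⟩ ⟨hl, le_rfl⟩, intervalIntegral.integral_of_le hl,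
    ← restrict_Ioo_eq_restrict_Ioc, ← integral_const_mul, L2.inner_def, L2.inner_def,
    ← integral_sub (L2.integrable_inner u v') (L2.integrable_inner v u')]
  refine integral_congr_ae ?_
  filter_upwards [hu, hv, hu', hv'] with x h1 h2 h3 h4
  rw [h1, h2, h3, h4, RCLike.inner_apply, RCLike.inner_apply, map_mul, map_neg, Complex.conj_ofReal]
  ring

end Edges

/-! ### Symmetric operators with surjective translates -/

section Symmetric

variable {E : Type*} [NormedAddCommGroup E] [InnerProductSpace ℂ E] {A : E →ₗ.[ℂ] E}

theorem abs_im_mul_norm_le_of_isFormalAdjoint (hA : A.IsFormalAdjoint A) (z : ℂ) (u : A.domain) :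
    |z.im| * ‖(u : E)‖ ≤ ‖A u - z • (u : E)‖ := by
  rcases eq_or_ne ‖(u : E)‖ 0 with h0 | h0
  · rw [h0, mul_zero]
    exact norm_nonneg _
  have h1 : (⟪(u : E), A u⟫_ℂ).im = 0 := by
    have h := inner_conj_symm (𝕜 := ℂ) (u : E) (A u)
    rw [hA u u] at h
    exact Complex.conj_eq_iff_im.1 h
  have h2 : (⟪(u : E), A u - z • (u : E)⟫_ℂ).im = -(z.im * ‖(u : E)‖ ^ 2) := by
    rw [inner_sub_right, inner_smul_right, inner_self_eq_norm_sq_to_K, Complex.sub_im, h1]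
    simp [← Complex.ofReal_pow]
  have h3 := (Complex.abs_im_le_norm _).trans (norm_inner_le_norm (𝕜 := ℂ) (u : E)
    (A u - z • (u : E)))
  rw [h2, abs_neg, abs_mul, abs_of_nonneg (sq_nonneg ‖(u : E)‖)] at h3
  have h4 : 0 < ‖(u : E)‖ := lt_of_le_of_ne (norm_nonneg _) (Ne.symm h0)
  nlinarith

theorem eq_of_isFormalAdjoint_of_sub_smul_eq (hA : A.IsFormalAdjoint A) {z : ℂ} (hz : z.im ≠ 0)
    {u v : A.domain} (h : A u - z • (u : E) = A v - z • (v : E)) : u = v := by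
  have h1 := abs_im_mul_norm_le_of_isFormalAdjoint hA z (u - v)
  have h2 : A (u - v) - z • ((u - v : A.domain) : E) = 0 := by
    rw [A.map_sub, Submodule.coe_sub, smul_sub, ← sub_eq_zero.2 h]
    abel
  rw [h2, norm_zero] at h1
  have h3 : ‖((u - v : A.domain) : E)‖ = 0 := by
    have : 0 < |z.im| := abs_pos.2 hz
    nlinarith [norm_nonneg ((u - v : A.domain) : E)]
  rw [norm_eq_zero, Submodule.coe_eq_zero, sub_eq_zero] at h3
  exact h3

theorem exists_isResolventAt (hA : A.IsFormalAdjoint A) {z : ℂ} (hz : z.im ≠ 0)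
    (hs : ∀ g, ∃ u : A.domain, A u - z • (u : E) = g) : ∃ R : E →L[ℂ] E, IsResolventAt A z R := by
  let T : A.domain →ₗ[ℂ] E := A.toFun - z • A.domain.subtype
  have hT (u : A.domain) : T u = A u - z • (u : E) := rfl
  let e : A.domain ≃ₗ[ℂ] E := LinearEquiv.ofBijective T
    ⟨fun u v h => eq_of_isFormalAdjoint_of_sub_smul_eq hA hz h, hs⟩
  have he (f : E) : A (e.symm f) - z • (e.symm f : E) = f := e.apply_symm_apply f
  have hpos : 0 < |z.im| := abs_pos.2 hz
  refine ⟨(A.domain.subtype ∘ₗ (e.symm : E →ₗ[ℂ] A.domain)).mkContinuous |z.im|⁻¹ fun f => ?_,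
    fun f => ⟨e.symm f, rfl, he f⟩, fun u => ?_⟩
  · have h := abs_im_mul_norm_le_of_isFormalAdjoint hA z (e.symm f)
    rw [he] at h
    rw [inv_mul_eq_div, le_div_iff₀ hpos, mul_comm]
    exact h
  · exact congrArg Subtype.val (e.symm_apply_apply u)

/-- A symmetric operator `A` for which `A - z` is surjective for all nonreal `z` is self-adjoint. -/
theorem isSelfAdjoint_of_isFormalAdjoint [CompleteSpace E] (hA : A.IsFormalAdjoint A)
    (hs : ∀ z : ℂ, z.im ≠ 0 → ∀ g, ∃ u : A.domain, A u - z • (u : E) = g) :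
    IsSelfAdjoint A := by
  have hI : Complex.I.im ≠ 0 := by simp
  have hI' : (-Complex.I).im ≠ 0 := by simp
  have hd : Dense (A.domain : Set E) := by
    rw [Submodule.dense_iff_topologicalClosure_eq_top, Submodule.topologicalClosure_eq_top_iff,
      Submodule.eq_bot_iff]
    intro h hh
    obtain ⟨u, hu⟩ := hs Complex.I hI h
    -- `h` is orthogonal to the domain, so `⟪v, (A - i) u⟫ = 0` for all `v` in the domain, and the
    -- left-hand side is `⟪(A + i) v, u⟫`.
    obtain ⟨v, hv⟩ := hs (-Complex.I) hI' (u : E)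
    have h1 : ⟪(v : E), h⟫_ℂ = 0 := (Submodule.mem_orthogonal _ _).1 hh v v.2
    rw [← hu, inner_sub_right, ← hA v u, inner_smul_right] at h1
    have h2 : ⟪(u : E), (u : E)⟫_ℂ = 0 := by
      nth_rw 1 [← hv]
      rw [inner_sub_left, inner_smul_left, map_neg, Complex.conj_I]
      linear_combination h1
    rw [inner_self_eq_zero, Submodule.coe_eq_zero] at h2
    rw [← hu, h2]
    simp
  have hle : A ≤ A.adjoint := LinearPMap.IsFormalAdjoint.le_adjoint hd hA
  rw [LinearPMap.isSelfAdjoint_def]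
  refine le_antisymm (LinearPMap.le_of_le_graph ?_) hle
  rintro ⟨y, w⟩ hyw
  rw [LinearPMap.mem_graph_iff] at hyw ⊢
  obtain ⟨y', hy', hw⟩ := hyw
  simp only at hy' hw
  obtain ⟨u, hu⟩ := hs Complex.I hI (w - Complex.I • y)
  obtain ⟨v, hv⟩ := hs (-Complex.I) hI' (y - u)
  -- With `(A - i) u = (A† - i) y` and `(A + i) v = y - u`, the vector `y - u` is orthogonal to
  -- itself, so `y = u` lies in the domain of `A`.
  have h1 : ⟪w, (v : E)⟫_ℂ = ⟪y, A v⟫_ℂ := by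
    rw [← hy', ← hw]
    exact LinearPMap.adjoint_isFormalAdjoint hd y' v
  have h2 : ⟪A u, (v : E)⟫_ℂ = ⟪(u : E), A v⟫_ℂ := hA u v
  have h3 : ⟪y - u, y - u⟫_ℂ = 0 := by
    nth_rw 2 [← hv]
    have h4 := congrArg (fun x => ⟪x, (v : E)⟫_ℂ) hu
    simp only [inner_sub_left, inner_smul_left, inner_sub_right, inner_smul_right,
      Complex.conj_I] at h4 ⊢
    rw [← h1, ← h2]
    linear_combination -h4
  rw [inner_self_eq_zero, sub_eq_zero] at h3
  refine ⟨u, h3.symm, ?_⟩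
  rw [← h3] at hu
  simpa using hu

end Symmetric

/-! ### Symmetry of the fibre operator and of the homogenised operator -/

section Graphs

variable {l₁ l₂ a₁ ε τ : ℝ}

theorem prod_inner_eq {E F : Type*} [NormedAddCommGroup E] [InnerProductSpace ℂ E]
    [NormedAddCommGroup F] [InnerProductSpace ℂ F] (x y : WithLp 2 (E × F)) :
    ⟪x, y⟫_ℂ = ⟪x.fst, y.fst⟫_ℂ + ⟪x.snd, y.snd⟫_ℂ := WithLp.prod_inner_apply x y

theorem fibreOp_mem_graph (hl₁ : 0 < l₁) (hl₂ : 0 < l₂) (u : (fibreOp l₁ l₂ a₁ ε τ).domain) :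
    ((u : H l₁ l₂), fibreOp l₁ l₂ a₁ ε τ u) ∈ fibreGraph l₁ l₂ a₁ ε τ := by
  rw [← fibreOp_graph hl₁ hl₂]
  exact LinearPMap.mem_graph _ u

theorem homOp_mem_graph (hl₂ : 0 < l₂) (u : (homOp l₁ l₂ τ).domain) :
    ((u : Hhom l₂), homOp l₁ l₂ τ u) ∈ homGraph l₁ l₂ τ := by
  rw [← homOp_graph l₁ hl₂]
  exact LinearPMap.mem_graph _ u

theorem exists_fibreOp_eq (hl₁ : 0 < l₁) (hl₂ : 0 < l₂) {p : H l₁ l₂ × H l₁ l₂}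
    (hp : p ∈ fibreGraph l₁ l₂ a₁ ε τ) :
    ∃ u : (fibreOp l₁ l₂ a₁ ε τ).domain, (u : H l₁ l₂) = p.1 ∧ fibreOp l₁ l₂ a₁ ε τ u = p.2 := by
  rwa [← fibreOp_graph hl₁ hl₂, LinearPMap.mem_graph_iff] at hp

theorem exists_homOp_eq (hl₂ : 0 < l₂) {p : Hhom l₂ × Hhom l₂} (hp : p ∈ homGraph l₁ l₂ τ) :
    ∃ u : (homOp l₁ l₂ τ).domain, (u : Hhom l₂) = p.1 ∧ homOp l₁ l₂ τ u = p.2 := by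
  rwa [← homOp_graph l₁ hl₂, LinearPMap.mem_graph_iff] at hp

theorem fibreOp_isFormalAdjoint (hl₁ : 0 < l₁) (hl₂ : 0 < l₂) :
    (fibreOp l₁ l₂ a₁ ε τ).IsFormalAdjoint (fibreOp l₁ l₂ a₁ ε τ) := by
  intro p q
  obtain ⟨s, s₁, t, t₁, h1, h2, h3, h4, h5, h6⟩ := fibreOp_mem_graph hl₁ hl₂ p
  obtain ⟨s', s₁', t', t₁', k1, k2, k3, k4, k5, k6⟩ := fibreOp_mem_graph hl₁ hl₂ q
  have e1 := h1.green hl₂.le k1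
  have e2 := h2.green hl₁.le k2
  rw [prod_inner_eq, prod_inner_eq]
  have c5 := congrArg conj h5
  have c6 := congrArg conj h6
  simp only [map_sub, map_add, map_neg, map_mul, Complex.conj_ofReal, map_zero] at c5 c6
  simp only [bdryForm, h3, h4, k3, k4, Complex.ofReal_one, one_mul] at e1 e2
  linear_combination -e1 - e2 + c5 * t' l₁ - k5 * conj (t l₁) + c6 * t' 0 - k6 * conj (t 0)

theorem exp_I_mul_ofReal_mul (a b : ℝ) :
    Complex.exp (Complex.I * a * b) = Complex.exp ((a * b : ℝ) * Complex.I) := by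
  congr 1
  push_cast
  ring

theorem norm_xi (l₁ τ : ℝ) : ‖xi l₁ τ‖ = 1 := by
  rw [xi, exp_I_mul_ofReal_mul, Complex.norm_exp_ofReal_mul_I]

theorem conj_xi_mul_xi (l₁ τ : ℝ) : conj (xi l₁ τ) * xi l₁ τ = 1 := by
  rw [RCLike.conj_mul, norm_xi]
  simp

/-- The gauge factor has modulus one. -/
theorem norm_exp_gauge (τ x : ℝ) : ‖Complex.exp (Complex.I * τ * x)‖ = 1 := by
  rw [exp_I_mul_ofReal_mul, Complex.norm_exp_ofReal_mul_I]

theorem norm_exp_neg_gauge (τ x : ℝ) : ‖Complex.exp (-(Complex.I * τ) * x)‖ = 1 := by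
  have := norm_exp_gauge (-τ) x
  push_cast at this
  rwa [mul_neg] at this

theorem homOp_isFormalAdjoint (hl₁ : 0 < l₁) (hl₂ : 0 < l₂) :
    (homOp l₁ l₂ τ).IsFormalAdjoint (homOp l₁ l₂ τ) := by
  intro p q
  obtain ⟨f, f₁, h1, h2, h3, h4⟩ := homOp_mem_graph hl₂ p
  obtain ⟨g, g₁, k1, k2, k3, k4⟩ := homOp_mem_graph hl₂ q
  have e1 := h1.green hl₂.le k1
  have hs : (Real.sqrt l₁ : ℂ) ≠ 0 := by exact_mod_cast (Real.sqrt_pos.2 hl₁).ne'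
  have hxi := conj_xi_mul_xi l₁ τ
  have hsc : conj (Real.sqrt l₁ : ℂ) = Real.sqrt l₁ := Complex.conj_ofReal _
  rw [prod_inner_eq, prod_inner_eq]
  simp only at h3 h4 k3 k4 e1
  rw [eq_div_iff hs] at h3 k3
  have h2' : f l₂ = xi l₁ τ * f 0 := by linear_combination (-f l₂) * hxi - xi l₁ τ * h2
  have k2' : g l₂ = xi l₁ τ * g 0 := by linear_combination (-g l₂) * hxi - xi l₁ τ * k2
  rw [RCLike.inner_apply, RCLike.inner_apply, h4, k4, ← h3, ← k3]
  simp only [bdryForm, h2', k2', map_mul, map_sub, map_neg, map_div₀, map_one, hsc,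
    Complex.conj_conj, Complex.ofReal_one, one_mul] at e1 ⊢
  field_simp
  linear_combination -e1

end Graphs

/-! ### Matching the vertex conditions -/

section Surjectivity

/-- A fundamental system of the homogeneous equation `-κ (d/dx + iτ)² f = z f` on one edge. -/
theorem exists_fundamentalSystem {l κ : ℝ} (hl : 0 ≤ l) (hκ : κ ≠ 0) (τ : ℝ) (z : ℂ) :
    ∃ m m₁ n n₁ : ℝ → ℂ, m 0 = 1 ∧ m₁ 0 = 0 ∧ n 0 = 0 ∧ n₁ 0 = 1 ∧
      ∀ a b : ℂ, ∃ u v : L2 l, EdgeRel l τ κ u v (a • m + b • n) (a • m₁ + b • n₁) ∧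
        v - z • u = 0 := by
  obtain ⟨u, v, m, m₁, h, e, h0, h1⟩ := exists_edgeRel_sub_smul_eq hl hκ τ z 1 0 0
  obtain ⟨u', v', n, n₁, h', e', h0', h1'⟩ := exists_edgeRel_sub_smul_eq hl hκ τ z 0 1 0
  refine ⟨m, m₁, n, n₁, h0, h1, h0', h1', fun a b => ⟨_, _, (h.smul a).add (h'.smul b), ?_⟩⟩
  rw [sub_eq_zero] at e e' ⊢
  rw [e, e', smul_add, smul_comm a z, smul_comm b z]

variable {l₁ l₂ a₁ ε τ : ℝ}

/-- The vertex conditions of the fibre operator, as a linear map in the representatives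
`(s, s', t, t')`. -/
def fibreVertexMap (l₁ l₂ κ τ : ℝ) :
    ((ℝ → ℂ) × (ℝ → ℂ)) × ((ℝ → ℂ) × (ℝ → ℂ)) →ₗ[ℂ] (ℂ × ℂ) × (ℂ × ℂ) where
  toFun p := ((p.1.1 0 - p.2.1 l₁, p.1.1 l₂ - p.2.1 0),
    (covDeriv τ p.1.1 p.1.2 0 - (κ : ℂ) * covDeriv τ p.2.1 p.2.2 l₁,
      -covDeriv τ p.1.1 p.1.2 l₂ + (κ : ℂ) * covDeriv τ p.2.1 p.2.2 0))
  map_add' p q := by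
    simp only [covDeriv, Prod.fst_add, Prod.snd_add, Pi.add_apply, Prod.mk_add_mk, Prod.mk.injEq]
    refine ⟨⟨?_, ?_⟩, ?_, ?_⟩ <;> ring
  map_smul' c p := by
    simp only [covDeriv, Prod.smul_fst, Prod.smul_snd, Pi.smul_apply, Prod.smul_mk, smul_eq_mul,
      Prod.mk.injEq, RingHom.id_apply]
    refine ⟨⟨?_, ?_⟩, ?_, ?_⟩ <;> ring

/-- The linear combinations `(a m + b n, a m' + b n')` as a linear map in `(a, b)`. -/
def combMap (m m₁ n n₁ : ℝ → ℂ) : ℂ × ℂ →ₗ[ℂ] (ℝ → ℂ) × (ℝ → ℂ) where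
  toFun c := (c.1 • m + c.2 • n, c.1 • m₁ + c.2 • n₁)
  map_add' c d := by
    simp only [Prod.fst_add, Prod.snd_add, add_smul, Prod.mk_add_mk]
    congr 1 <;> abel
  map_smul' c d := by simp [mul_smul]

theorem combMap_eq_zero {l : ℝ} (hl : 0 ≤ l) {m m₁ n n₁ : ℝ → ℂ} (h1 : m 0 = 1) (h2 : m₁ 0 = 0)
    (h3 : n 0 = 0) (h4 : n₁ 0 = 1) {c : ℂ × ℂ} (hf : EqOn (combMap m m₁ n n₁ c).1 0 (Icc 0 l))
    (hf₁ : EqOn (combMap m m₁ n n₁ c).2 0 (Icc 0 l)) : c = 0 := by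
  have e1 := hf ⟨le_rfl, hl⟩
  have e2 := hf₁ ⟨le_rfl, hl⟩
  simp only [combMap, LinearMap.coe_mk, AddHom.coe_mk, Pi.add_apply, Pi.smul_apply, smul_eq_mul,
    h1, h2, h3, h4, mul_one, mul_zero, add_zero, zero_add, Pi.zero_apply] at e1 e2
  exact Prod.ext e1 e2

/-- An injective linear map onto a space of the same dimension can compensate any defect. -/
theorem exists_map_add_eq_zero {V X W : Type*} [AddCommGroup V] [Module ℂ V] [AddCommGroup X]
    [Module ℂ X] [AddCommGroup W] [Module ℂ W] [FiniteDimensional ℂ V] [FiniteDimensional ℂ W]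
    (hd : Module.finrank ℂ V = Module.finrank ℂ W) (B : X →ₗ[ℂ] W) (L : V →ₗ[ℂ] X)
    (h : ∀ v, B (L v) = 0 → v = 0) (w : W) : ∃ v, w + B (L v) = 0 := by
  have hi : Function.Injective (B ∘ₗ L) := by
    rw [injective_iff_map_eq_zero]
    exact h
  obtain ⟨v, hv⟩ := (LinearMap.injective_iff_surjective_of_finrank_eq_finrank hd).1 hi (-w)
  exact ⟨v, by rw [LinearMap.comp_apply] at hv; rw [hv, add_neg_cancel]⟩

/-- For nonreal `z` the operator `A_ε - z` is surjective: a solution on each edge without regard to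
the vertex conditions is corrected by homogeneous solutions. -/
theorem fibreOp_sub_smul_surjective (hl₁ : 0 < l₁) (hl₂ : 0 < l₂) (ha₁ : 0 < a₁) (hε : 0 < ε)
    {z : ℂ} (hz : z.im ≠ 0) (g : H l₁ l₂) :
    ∃ u : (fibreOp l₁ l₂ a₁ ε τ).domain, fibreOp l₁ l₂ a₁ ε τ u - z • (u : H l₁ l₂) = g := by
  have hκ : a₁ ^ 2 / ε ^ 2 ≠ 0 := by positivity
  obtain ⟨m, m₁, n, n₁, hm, hm₁, hn, hn₁, hS⟩ :=
    exists_fundamentalSystem hl₂.le one_ne_zero τ z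
  obtain ⟨m', m₁', n', n₁', hm', hm₁', hn', hn₁', hT⟩ :=
    exists_fundamentalSystem hl₁.le hκ τ z
  obtain ⟨us, vs, s, s₁, h1, e1, -⟩ :=
    exists_edgeRel_sub_smul_eq hl₂.le one_ne_zero τ z 0 0 g.fst
  obtain ⟨ut, vt, t, t₁, h2, e2, -⟩ :=
    exists_edgeRel_sub_smul_eq hl₁.le hκ τ z 0 0 g.snd
  obtain ⟨⟨c, d⟩, hcd⟩ := exists_map_add_eq_zero rfl (fibreVertexMap l₁ l₂ (a₁ ^ 2 / ε ^ 2) τ)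
    ((combMap m m₁ n n₁).prodMap (combMap m' m₁' n' n₁')) (by
      -- A combination of homogeneous solutions without defect is an eigenfunction of a symmetric
      -- operator with a nonreal eigenvalue, hence zero.
      rintro ⟨c, d⟩ h0
      obtain ⟨u, v, hu, e⟩ := hS c.1 c.2
      obtain ⟨u', v', hu', e'⟩ := hT d.1 d.2
      simp only [fibreVertexMap, LinearMap.coe_mk, AddHom.coe_mk, Prod.mk_eq_zero,
        LinearMap.prodMap_apply, sub_eq_zero] at h0
      obtain ⟨p, hp, hp'⟩ := exists_fibreOp_eq (a₁ := a₁) (ε := ε) (τ := τ)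
        (p := (WithLp.toLp 2 (u, u'), WithLp.toLp 2 (v, v'))) hl₁ hl₂
        ⟨_, _, _, _, hu, hu', h0.1.1, h0.1.2, sub_eq_zero.2 h0.2.1, h0.2.2⟩
      have hp0 : p = 0 := by
        refine eq_of_isFormalAdjoint_of_sub_smul_eq (fibreOp_isFormalAdjoint hl₁ hl₂) hz ?_
        rw [hp, hp', LinearPMap.map_zero, Submodule.coe_zero, smul_zero, sub_zero]
        exact WithLp.ofLp_injective 2 (Prod.ext e e')
      rw [hp0, Submodule.coe_zero] at hp
      have hu0 : u = 0 := (congrArg WithLp.fst hp).symm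
      have hu0' : u' = 0 := (congrArg WithLp.snd hp).symm
      subst hu0 hu0'
      obtain ⟨-, k1, k2⟩ := EdgeRel.eq_zero hl₂ hu
      obtain ⟨-, k3, k4⟩ := EdgeRel.eq_zero hl₁ hu'
      exact Prod.ext (combMap_eq_zero hl₂.le hm hm₁ hn hn₁ k1 k2)
        (combMap_eq_zero hl₁.le hm' hm₁' hn' hn₁' k3 k4))
    (fibreVertexMap l₁ l₂ (a₁ ^ 2 / ε ^ 2) τ ((s, s₁), (t, t₁)))
  rw [← map_add] at hcd
  obtain ⟨u, v, hu, e⟩ := hS c.1 c.2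
  obtain ⟨u', v', hu', e'⟩ := hT d.1 d.2
  simp only [fibreVertexMap, LinearMap.coe_mk, AddHom.coe_mk, Prod.mk_eq_zero,
    LinearMap.prodMap_apply, sub_eq_zero] at hcd
  obtain ⟨p, hp, hp'⟩ := exists_fibreOp_eq (a₁ := a₁) (ε := ε) (τ := τ)
    (p := (WithLp.toLp 2 (us + u, ut + u'), WithLp.toLp 2 (vs + v, vt + v'))) hl₁ hl₂
    ⟨_, _, _, _, h1.add hu, h2.add hu', hcd.1.1, hcd.1.2, sub_eq_zero.2 hcd.2.1, hcd.2.2⟩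
  refine ⟨p, ?_⟩
  rw [hp, hp']
  refine WithLp.ofLp_injective 2 (Prod.ext ?_ ?_)
  · change vs + v - z • (us + u) = g.fst
    rw [← e1, ← add_zero (vs - z • us), ← e, smul_add]
    abel
  · change vt + v' - z • (ut + u') = g.snd
    rw [← e2, ← add_zero (vt - z • ut), ← e', smul_add]
    abel

/-- The two scalar equations that `(𝒜_hom - z)(u, β) = (·, γ)` and the domain impose on the
boundary values of `u`, as a linear map in the representatives `(f, f')`; the unknown `β` is
eliminated by `β = √l₁ f(0)`. -/
noncomputable def homVertexMap (l₁ l₂ τ : ℝ) (z : ℂ) : (ℝ → ℂ) × (ℝ → ℂ) →ₗ[ℂ] ℂ × ℂ where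
  toFun p := (p.1 0 - conj (xi l₁ τ) * p.1 l₂,
    -(1 / (Real.sqrt l₁ : ℂ)) *
      (covDeriv τ p.1 p.2 0 - conj (xi l₁ τ) * covDeriv τ p.1 p.2 l₂) -
        z * (Real.sqrt l₁ * p.1 0))
  map_add' p q := by
    simp only [covDeriv, Prod.fst_add, Prod.snd_add, Pi.add_apply, Prod.mk_add_mk, Prod.mk.injEq]
    refine ⟨?_, ?_⟩ <;> ring
  map_smul' c p := by
    simp only [covDeriv, Prod.smul_fst, Prod.smul_snd, Pi.smul_apply, Prod.smul_mk, smul_eq_mul,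
      Prod.mk.injEq, RingHom.id_apply]
    refine ⟨?_, ?_⟩ <;> ring

/-- If the representatives of `u` satisfy the equations encoded in `homVertexMap`, then the
homogenised equation `(𝒜_hom - z) p = g` is solvable. -/
theorem exists_homOp_sub_smul_eq (hl₁ : 0 < l₁) (hl₂ : 0 < l₂) {z : ℂ} {u v : L2 l₂}
    {f f₁ : ℝ → ℂ} (h : EdgeRel l₂ τ 1 u v f f₁) {γ : ℂ}
    (hB : homVertexMap l₁ l₂ τ z (f, f₁) = (0, γ)) :
    ∃ p : (homOp l₁ l₂ τ).domain, (p : Hhom l₂).fst = u ∧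
      homOp l₁ l₂ τ p - z • (p : Hhom l₂) = WithLp.toLp 2 (v - z • u, γ) := by
  have hs : (Real.sqrt l₁ : ℂ) ≠ 0 := by exact_mod_cast (Real.sqrt_pos.2 hl₁).ne'
  simp only [homVertexMap, LinearMap.coe_mk, AddHom.coe_mk, Prod.mk.injEq, sub_eq_zero] at hB
  obtain ⟨p, hp, hp'⟩ := exists_homOp_eq (l₁ := l₁) (τ := τ)
    (p := (WithLp.toLp 2 (u, Real.sqrt l₁ * f 0), WithLp.toLp 2 (v, -(1 / (Real.sqrt l₁ : ℂ)) *
      (covDeriv τ f f₁ 0 - conj (xi l₁ τ) * covDeriv τ f f₁ l₂)))) hl₂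
    ⟨f, f₁, h, hB.1, (mul_div_cancel_left₀ _ hs).symm, rfl⟩
  refine ⟨p, congrArg WithLp.fst hp, ?_⟩
  rw [hp, hp']
  exact WithLp.ofLp_injective 2 (Prod.ext rfl hB.2)

theorem homOp_sub_smul_surjective (hl₁ : 0 < l₁) (hl₂ : 0 < l₂)
    {z : ℂ} (hz : z.im ≠ 0) (g : Hhom l₂) :
    ∃ u : (homOp l₁ l₂ τ).domain, homOp l₁ l₂ τ u - z • (u : Hhom l₂) = g := by
  obtain ⟨m, m₁, n, n₁, hm, hm₁, hn, hn₁, hS⟩ :=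
    exists_fundamentalSystem hl₂.le one_ne_zero τ z
  obtain ⟨us, vs, s, s₁, h1, e1, -⟩ :=
    exists_edgeRel_sub_smul_eq hl₂.le one_ne_zero τ z 0 0 g.fst
  obtain ⟨c, hc⟩ := exists_map_add_eq_zero rfl (homVertexMap l₁ l₂ τ z) (combMap m m₁ n n₁) (by
      intro c h0
      obtain ⟨u, v, hu, e⟩ := hS c.1 c.2
      obtain ⟨p, hp, hp'⟩ := exists_homOp_sub_smul_eq hl₁ hl₂ hu (γ := 0) h0
      have hp0 : p = 0 := by
        refine eq_of_isFormalAdjoint_of_sub_smul_eq (homOp_isFormalAdjoint hl₁ hl₂) hz ?_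
        rw [hp', e, LinearPMap.map_zero, Submodule.coe_zero, smul_zero, sub_zero]
        rfl
      rw [hp0] at hp
      have hu0 : u = 0 := hp.symm
      subst hu0
      obtain ⟨-, k1, k2⟩ := EdgeRel.eq_zero hl₂ hu
      exact combMap_eq_zero hl₂.le hm hm₁ hn hn₁ k1 k2)
    (homVertexMap l₁ l₂ τ z (s, s₁) - (0, g.snd))
  rw [sub_add_eq_add_sub, sub_eq_zero, ← map_add] at hc
  obtain ⟨u, v, hu, e⟩ := hS c.1 c.2
  obtain ⟨p, -, hp⟩ := exists_homOp_sub_smul_eq hl₁ hl₂ (h1.add hu) hc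
  refine ⟨p, hp.trans (WithLp.ofLp_injective 2 (Prod.ext ?_ rfl))⟩
  change vs + v - z • (us + u) = g.fst
  rw [← e1, ← add_zero (vs - z • us), ← e, smul_add]
  abel

theorem fibreOp_isSelfAdjoint (hl₁ : 0 < l₁) (hl₂ : 0 < l₂) (ha₁ : 0 < a₁) (hε : 0 < ε) :
    IsSelfAdjoint (fibreOp l₁ l₂ a₁ ε τ) :=
  isSelfAdjoint_of_isFormalAdjoint (fibreOp_isFormalAdjoint hl₁ hl₂)
    fun _ hz => fibreOp_sub_smul_surjective hl₁ hl₂ ha₁ hε hz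

theorem homOp_isSelfAdjoint (hl₁ : 0 < l₁) (hl₂ : 0 < l₂) : IsSelfAdjoint (homOp l₁ l₂ τ) :=
  isSelfAdjoint_of_isFormalAdjoint (homOp_isFormalAdjoint hl₁ hl₂)
    fun _ hz => homOp_sub_smul_surjective hl₁ hl₂ hz

end Surjectivity

/-! ### The stiff mode and the operator `Ψ` -/

section PartialIsometry

variable {l₁ l₂ τ κ : ℝ}

theorem Psi_fst (x : H l₁ l₂) : (Psi l₁ l₂ τ x).fst = x.fst := rfl

theorem Psi_snd (x : H l₁ l₂) : (Psi l₁ l₂ τ x).snd = ⟪stiffMode l₁ τ, x.snd⟫_ℂ := rfl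

theorem adjoint_Psi_apply (y : Hhom l₂) :
    ContinuousLinearMap.adjoint (Psi l₁ l₂ τ) y =
      WithLp.toLp 2 (y.fst, y.snd • stiffMode l₁ τ) := by
  refine ext_inner_right ℂ fun x => ?_
  rw [ContinuousLinearMap.adjoint_inner_left, prod_inner_eq, prod_inner_eq, Psi_fst, Psi_snd,
    RCLike.inner_apply]
  simp only [WithLp.toLp_fst, WithLp.toLp_snd, inner_smul_left]
  ring

theorem stiffModeFun_eq (l₁ τ x : ℝ) :
    stiffModeFun l₁ τ x = xi l₁ τ * Complex.exp (-(Complex.I * τ) * x) / Real.sqrt l₁ := by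
  rw [stiffModeFun, xi, ← Complex.exp_add]
  congr 2
  ring

theorem coeFn_stiffMode (l₁ τ : ℝ) :
    stiffMode l₁ τ =ᵐ[volume.restrict (Ioo (0 : ℝ) l₁)] stiffModeFun l₁ τ :=
  (memLp_stiffModeFun l₁ τ).coeFn_toLp

theorem norm_stiffMode (hl₁ : 0 < l₁) : ‖stiffMode l₁ τ‖ = 1 := by
  have hs : (Real.sqrt l₁) ^ 2 = l₁ := Real.sq_sqrt hl₁.le
  have h : ⟪stiffMode l₁ τ, stiffMode l₁ τ⟫_ℂ = 1 := by
    have : ⟪stiffMode l₁ τ, stiffMode l₁ τ⟫_ℂ =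
        ∫ _ in Ioo (0 : ℝ) l₁, ((1 / l₁ : ℝ) : ℂ) := by
      rw [L2.inner_def]
      refine integral_congr_ae ?_
      filter_upwards [coeFn_stiffMode l₁ τ] with x hx
      rw [hx, inner_self_eq_norm_sq_to_K, stiffModeFun_eq, norm_div, norm_mul, norm_xi,
        norm_exp_neg_gauge, Complex.norm_real, Real.norm_of_nonneg (Real.sqrt_nonneg _), mul_one]
      rw [← hs, Real.sqrt_sq (Real.sqrt_nonneg _)]
      push_cast
      simp
    rw [this]
    simp [hl₁.le, hl₁.ne']
  rw [inner_self_eq_norm_sq_to_K] at h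
  have h' : ‖stiffMode l₁ τ‖ ^ 2 = 1 := Complex.ofReal_injective (by push_cast; exact h)
  nlinarith [norm_nonneg (stiffMode l₁ τ)]

theorem Psi_comp_adjoint (hl₁ : 0 < l₁) :
    Psi l₁ l₂ τ ∘L ContinuousLinearMap.adjoint (Psi l₁ l₂ τ) =
      ContinuousLinearMap.id ℂ (Hhom l₂) := by
  ext1 y
  rw [ContinuousLinearMap.comp_apply, adjoint_Psi_apply]
  refine WithLp.ofLp_injective 2 (Prod.ext rfl ?_)
  change ⟪stiffMode l₁ τ, y.snd • stiffMode l₁ τ⟫_ℂ = y.snd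
  rw [inner_smul_right, inner_self_eq_norm_sq_to_K, norm_stiffMode hl₁]
  simp

theorem norm_adjoint_Psi_apply (hl₁ : 0 < l₁) (y : Hhom l₂) :
    ‖ContinuousLinearMap.adjoint (Psi l₁ l₂ τ) y‖ = ‖y‖ := by
  rw [adjoint_Psi_apply, WithLp.prod_norm_eq_of_L2, WithLp.prod_norm_eq_of_L2]
  simp [norm_smul, norm_stiffMode hl₁]

/-- The stiff mode is annihilated by `d/dx + iτ`. -/
theorem edgeRel_stiffMode (l₁ τ κ : ℝ) :
    EdgeRel l₁ τ κ (stiffMode l₁ τ) 0 (stiffModeFun l₁ τ)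
      (fun x => -(Complex.I * τ) * stiffModeFun l₁ τ x) := by
  have h : IsPrimitiveOn l₁ (stiffModeFun l₁ τ)
      (fun x => -(Complex.I * τ) * stiffModeFun l₁ τ x) := by
    convert (IsPrimitiveOn.exp l₁ (-(Complex.I * τ))).const_mul (xi l₁ τ / Real.sqrt l₁)
      using 2 with x x
    · rw [stiffModeFun_eq]
      ring
    · rw [stiffModeFun_eq]
      ring
  have h' := h.const_mul (-(Complex.I * τ))
  refine ⟨_, ⟨?_, h.eq_add_integral, h'.eq_add_integral⟩, coeFn_stiffMode l₁ τ, ?_⟩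
  · exact ((memLp_stiffModeFun l₁ τ).const_mul _).const_mul _
  · filter_upwards [Lp.coeFn_zero ℂ 2 (volume.restrict (Ioo (0 : ℝ) l₁))] with x hx
    rw [hx, covDerivTwo]
    ring_nf
    simp

theorem covDeriv_stiffModeFun (l₁ τ x : ℝ) :
    covDeriv τ (stiffModeFun l₁ τ) (fun x => -(Complex.I * τ) * stiffModeFun l₁ τ x) x = 0 := by
  rw [covDeriv]
  ring

end PartialIsometry

/-! ### Bounds on one edge -/

section Bounds

variable {l τ κ : ℝ} {f f₁ : ℝ → ℂ} {u v : L2 l}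

theorem norm_le_of_ae_norm_le (hl : 0 ≤ l) {C : ℝ} (hC : 0 ≤ C)
    (h : ∀ᵐ x ∂volume.restrict (Ioo (0 : ℝ) l), ‖u x‖ ≤ C) : ‖u‖ ≤ Real.sqrt l * C := by
  have h1 := Lp.norm_le_of_ae_bound hC h
  rwa [measureUnivNNReal, Measure.restrict_apply_univ, Real.volume_Ioo, sub_zero,
    show ((ENNReal.ofReal l).toNNReal : ℝ) = l from ENNReal.toReal_ofReal hl, ENNReal.toReal_ofNat,
    ← one_div, ← Real.sqrt_eq_rpow] at h1

theorem integral_norm_le (hl : 0 ≤ l) (u : L2 l) :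
    ∫ x in Ioo (0 : ℝ) l, ‖u x‖ ≤ Real.sqrt l * ‖u‖ := by
  have hu := (Lp.memLp u).aestronglyMeasurable
  have h := eLpNorm_le_eLpNorm_mul_rpow_measure_univ (p := 1) (q := 2) (by norm_num) hu
  rw [Measure.restrict_apply_univ, Real.volume_Ioo, sub_zero, ENNReal.toReal_one,
    ENNReal.toReal_ofNat] at h
  have h' := ENNReal.toReal_mono (ENNReal.mul_ne_top (Lp.eLpNorm_ne_top u)
    (ENNReal.rpow_ne_top_of_nonneg (by norm_num) ENNReal.ofReal_ne_top)) h
  rw [ENNReal.toReal_mul, ← ENNReal.toReal_rpow, ENNReal.toReal_ofReal hl, ← Lp.norm_def,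
    eLpNorm_one_eq_lintegral_enorm, ← integral_norm_eq_lintegral_enorm hu] at h'
  rw [Real.sqrt_eq_rpow, mul_comm]
  norm_num at h' ⊢
  exact h'

/-- Green's identity with the gauged test function `exp(-iτx) p(x)`: the bracket of boundary values
is bounded by the graph norm, and the bound depends only on `p`, because the gauge factor has
modulus one. -/
theorem exists_norm_bdry_le (hl : 0 ≤ l) {p p₁ p₂ : ℝ → ℂ} (hp : ∀ x, HasDerivAt p (p₁ x) x)
    (hp₁ : ∀ x, HasDerivAt p₁ (p₂ x) x) (hc : Continuous p₂) :
    ∃ C : ℝ, 0 ≤ C ∧ ∀ (τ : ℝ) (u v : L2 l) (f f₁ : ℝ → ℂ), EdgeRel l τ 1 u v f f₁ →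
      ‖conj (covDeriv τ f f₁ l) * (Complex.exp (-(Complex.I * τ) * l) * p l) -
        conj (f l) * (Complex.exp (-(Complex.I * τ) * l) * p₁ l) -
        (conj (covDeriv τ f f₁ 0) * p 0 - conj (f 0) * p₁ 0)‖ ≤ C * (‖u‖ + ‖v‖) := by
  have hcp₁ : Continuous p₁ := continuous_iff_continuousAt.2 fun x => (hp₁ x).continuousAt
  have hcp : Continuous p := continuous_iff_continuousAt.2 fun x => (hp x).continuousAt
  obtain ⟨B, hB⟩ := isCompact_Icc.exists_bound_of_continuousOn (hcp.continuousOn (s := Icc 0 l))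
  obtain ⟨B₂, hB₂⟩ := isCompact_Icc.exists_bound_of_continuousOn (hc.continuousOn (s := Icc 0 l))
  have hl0 : (0 : ℝ) ∈ Icc (0 : ℝ) l := ⟨le_rfl, hl⟩
  have hB0 : 0 ≤ B := (norm_nonneg _).trans (hB 0 hl0)
  have hB₂0 : 0 ≤ B₂ := (norm_nonneg _).trans (hB₂ 0 hl0)
  refine ⟨Real.sqrt l * (B + B₂), by positivity, fun τ u v f f₁ h => ?_⟩
  set μ : ℂ := -(Complex.I * τ) with hμ
  have hP : IsPrimitiveOn l p p₁ := IsPrimitiveOn.of_hasDerivAt hp hcp₁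
  have hP₁ : IsPrimitiveOn l p₁ p₂ := IsPrimitiveOn.of_hasDerivAt hp₁ hc
  have k := (IsPrimitiveOn.exp l μ).mul hl hP
  have k₁ := (((IsPrimitiveOn.exp l μ).mul hl hP).const_mul μ).add
    ((IsPrimitiveOn.exp l μ).mul hl hP₁)
  have hW : IsW22 l (fun x => Complex.exp (μ * x) * p x)
      (fun x => μ * (Complex.exp (μ * x) * p x) + Complex.exp (μ * x) * p₁ x)
      (fun x => μ * (μ * Complex.exp (μ * x) * p x + Complex.exp (μ * x) * p₁ x) +
        (μ * Complex.exp (μ * x) * p₁ x + Complex.exp (μ * x) * p₂ x)) := by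
    refine ⟨memLp_of_continuousOn (by fun_prop), fun x hx => ?_, k₁.eq_add_integral⟩
    rw [k.eq_add_integral x hx]
    simp only [mul_assoc]
  obtain ⟨U, V, hUV, hV⟩ := hW.exists_edgeRel τ 1
  have hU : ‖U‖ ≤ Real.sqrt l * B := by
    obtain ⟨-, -, hU, -⟩ := hUV
    refine norm_le_of_ae_norm_le hl hB0 ?_
    filter_upwards [hU, ae_restrict_mem measurableSet_Ioo] with x hx hxl
    rw [hx, norm_mul, norm_exp_neg_gauge, one_mul]
    exact hB x (Ioo_subset_Icc_self hxl)
  have hV' : ‖V‖ ≤ Real.sqrt l * B₂ := by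
    refine norm_le_of_ae_norm_le hl hB₂0 ?_
    filter_upwards [hV, ae_restrict_mem measurableSet_Ioo] with x hx hxl
    have : V x = -(Complex.exp (μ * x) * p₂ x) := by
      rw [hx, covDerivTwo, hμ]
      push_cast
      ring_nf
      simp only [Complex.I_sq]
      ring
    rw [this, norm_neg, norm_mul, norm_exp_neg_gauge, one_mul]
    exact hB₂ x (Ioo_subset_Icc_self hxl)
  have hG := h.green hl hUV
  have e : conj (covDeriv τ f f₁ l) * (Complex.exp (μ * l) * p l) -
        conj (f l) * (Complex.exp (μ * l) * p₁ l) -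
        (conj (covDeriv τ f f₁ 0) * p 0 - conj (f 0) * p₁ 0) = ⟪u, V⟫_ℂ - ⟪v, U⟫_ℂ := by
    rw [hG]
    simp only [bdryForm, covDeriv, Complex.ofReal_zero, mul_zero, Complex.exp_zero, hμ,
      Complex.ofReal_one]
    ring
  rw [e]
  calc ‖⟪u, V⟫_ℂ - ⟪v, U⟫_ℂ‖ ≤ ‖u‖ * ‖V‖ + ‖v‖ * ‖U‖ :=
        (norm_sub_le _ _).trans (add_le_add (norm_inner_le_norm _ _) (norm_inner_le_norm _ _))
    _ ≤ ‖u‖ * (Real.sqrt l * (B + B₂)) + ‖v‖ * (Real.sqrt l * (B + B₂)) := by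
        have := Real.sqrt_nonneg l
        gcongr
        · exact hV'.trans (by gcongr; linarith)
        · exact hU.trans (by gcongr; linarith)
    _ = Real.sqrt l * (B + B₂) * (‖u‖ + ‖v‖) := by ring

/-- On one edge the boundary values of `∂f` are controlled by the graph norm, uniformly in `τ`. -/
theorem exists_norm_covDeriv_le (hl : 0 < l) :
    ∃ C : ℝ, 0 ≤ C ∧ ∀ (τ : ℝ) (u v : L2 l) (f f₁ : ℝ → ℂ), EdgeRel l τ 1 u v f f₁ →
      ‖covDeriv τ f f₁ 0‖ ≤ C * (‖u‖ + ‖v‖) ∧ ‖covDeriv τ f f₁ l‖ ≤ C * (‖u‖ + ‖v‖) := by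
  have hl' : (l : ℂ) ≠ 0 := by exact_mod_cast hl.ne'
  -- The cubic with `p(0) = 0`, `p(l) = 1` and `p'(0) = p'(l) = 0`.
  have hp (x : ℝ) : HasDerivAt (fun x : ℝ => 3 / (l : ℂ) ^ 2 * (x : ℂ) ^ 2 -
      2 / (l : ℂ) ^ 3 * (x : ℂ) ^ 3) (6 / (l : ℂ) ^ 2 * x - 6 / (l : ℂ) ^ 3 * (x : ℂ) ^ 2) x := by
    have h1 : HasDerivAt (fun x : ℝ => (x : ℂ)) 1 x := Complex.ofRealCLM.hasDerivAt
    refine (((h1.pow 2).const_mul _).sub ((h1.pow 3).const_mul _)).congr_deriv ?_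
    norm_num
    ring
  have hp₁ (x : ℝ) : HasDerivAt (fun x : ℝ => 6 / (l : ℂ) ^ 2 * (x : ℂ) -
      6 / (l : ℂ) ^ 3 * (x : ℂ) ^ 2) (6 / (l : ℂ) ^ 2 - 12 / (l : ℂ) ^ 3 * (x : ℂ)) x := by
    have h1 : HasDerivAt (fun x : ℝ => (x : ℂ)) 1 x := Complex.ofRealCLM.hasDerivAt
    refine ((h1.const_mul _).sub ((h1.pow 2).const_mul _)).congr_deriv ?_
    norm_num
    ring
  obtain ⟨C, hC, h⟩ := exists_norm_bdry_le hl.le hp hp₁ (by fun_prop)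
  obtain ⟨C', hC', h'⟩ := exists_norm_bdry_le hl.le (fun x => (hp x).const_sub 1)
    (fun x => (hp₁ x).neg) (by fun_prop)
  have ep : 3 / (l : ℂ) ^ 2 * (l : ℂ) ^ 2 - 2 / (l : ℂ) ^ 3 * (l : ℂ) ^ 3 = 1 := by
    field_simp
    norm_num
  have ep₁ : 6 / (l : ℂ) ^ 2 * (l : ℂ) - 6 / (l : ℂ) ^ 3 * (l : ℂ) ^ 2 = 0 := by
    field_simp
    norm_num
  refine ⟨C + C', by positivity, fun τ u v f f₁ huv => ⟨?_, ?_⟩⟩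
  · have k := h' τ u v f f₁ huv
    simp only [ep, ep₁] at k
    simp only [sub_self, mul_zero, neg_zero, Complex.ofReal_zero, ne_eq, OfNat.ofNat_ne_zero,
      not_false_eq_true, zero_pow, sub_zero, mul_one, zero_sub, norm_neg, RCLike.norm_conj] at k
    exact k.trans (by gcongr; linarith)
  · have k := h τ u v f f₁ huv
    simp only [ep, ep₁] at k
    simp only [sub_self, mul_zero, Complex.ofReal_zero, ne_eq, OfNat.ofNat_ne_zero,
      not_false_eq_true, zero_pow, sub_zero, mul_one, norm_mul, norm_exp_neg_gauge,
      RCLike.norm_conj] at k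
    exact k.trans (by gcongr; linarith)

/-- Multiplication by `exp(iτx)` turns `d/dx + iτ` into `d/dx`. -/
theorem IsPrimitiveOn.gauge (hl : 0 ≤ l) (h : IsPrimitiveOn l f f₁) (τ : ℝ) :
    IsPrimitiveOn l (fun x => Complex.exp (Complex.I * τ * x) * f x)
      (fun x => Complex.exp (Complex.I * τ * x) * covDeriv τ f f₁ x) := by
  convert (IsPrimitiveOn.exp l (Complex.I * τ)).mul hl h using 2 with x
  rw [covDeriv]
  ring

/-- The variation of `∂f` along an edge with coefficient `κ` is of order `κ⁻¹`. -/
theorem EdgeRel.norm_covDeriv_le (hl : 0 ≤ l) (hκ : 0 < κ) (h : EdgeRel l τ κ u v f f₁) {x : ℝ}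
    (hx : x ∈ Icc (0 : ℝ) l) :
    κ * ‖covDeriv τ f f₁ x‖ ≤ κ * ‖covDeriv τ f f₁ l‖ + Real.sqrt l * ‖v‖ := by
  obtain ⟨f₂, hf, -, hv⟩ := h
  have hll : l ∈ Icc (0 : ℝ) l := ⟨hl, le_rfl⟩
  have h2 : IsPrimitiveOn l (fun x => Complex.exp (Complex.I * τ * x) * covDeriv τ f f₁ x)
      (fun x => Complex.exp (Complex.I * τ * x) * covDerivTwo τ f f₁ f₂ x) := by
    convert ((hf.isPrimitiveOn_deriv hl).add
      ((hf.isPrimitiveOn hl).const_mul (Complex.I * τ))).gauge hl τ using 3 with x x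
    · rfl
    · simp only [covDerivTwo, covDeriv]
      ring_nf
      simp only [Complex.I_sq]
      ring
  have h3 := h2.sub_eq_integral hx hll
  have h4 : κ * ‖∫ t in x..l, Complex.exp (Complex.I * τ * t) * covDerivTwo τ f f₁ f₂ t‖ ≤
      Real.sqrt l * ‖v‖ := by
    calc κ * ‖∫ t in x..l, Complex.exp (Complex.I * τ * t) * covDerivTwo τ f f₁ f₂ t‖
        ≤ κ * ∫ t in (0 : ℝ)..l,
            ‖Complex.exp (Complex.I * τ * t) * covDerivTwo τ f f₁ f₂ t‖ := by
          gcongr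
          refine (intervalIntegral.norm_integral_le_integral_norm hx.2).trans ?_
          exact intervalIntegral.integral_mono_interval hx.1 hx.2 le_rfl
            (Filter.Eventually.of_forall fun t => norm_nonneg _) h2.integrable.norm
      _ = ∫ t in Ioo (0 : ℝ) l, ‖v t‖ := by
          rw [intervalIntegral.integral_of_le hl, ← restrict_Ioo_eq_restrict_Ioc,
            ← integral_const_mul]
          refine integral_congr_ae ?_
          filter_upwards [hv] with t ht
          rw [ht, norm_mul, norm_exp_gauge, norm_mul, norm_neg, Complex.norm_real,
            Real.norm_of_nonneg hκ.le, one_mul]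
      _ ≤ _ := integral_norm_le hl v
  rw [← h3] at h4
  have h5 := norm_sub_norm_le (Complex.exp (Complex.I * τ * x) * covDeriv τ f f₁ x)
    (Complex.exp (Complex.I * τ * l) * covDeriv τ f f₁ l)
  rw [norm_mul, norm_mul, norm_exp_gauge, norm_exp_gauge, one_mul, one_mul, norm_sub_rev] at h5
  nlinarith [mul_le_mul_of_nonneg_left h5 hκ.le]

/-- The deviation of a function on the stiff edge from its projection onto the stiff mode is
controlled by the supremum of its covariant derivative. -/
theorem EdgeRel.norm_sub_stiffMode_le (hl : 0 < l) (h : EdgeRel l τ κ u v f f₁) {δ : ℝ}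
    (hδ : ∀ x ∈ Icc (0 : ℝ) l, ‖covDeriv τ f f₁ x‖ ≤ δ) {x : ℝ} (hx : x ∈ Icc (0 : ℝ) l) :
    ‖f x - ⟪stiffMode l τ, u⟫_ℂ * stiffModeFun l τ x‖ ≤ l * δ := by
  obtain ⟨f₂, hf, hu, -⟩ := h
  have hg := (hf.isPrimitiveOn hl.le).gauge hl.le τ
  set g : ℝ → ℂ := fun x => Complex.exp (Complex.I * τ * x) * f x with hgdef
  have hl' : (l : ℂ) ≠ 0 := by exact_mod_cast hl.ne'
  have hs : (Real.sqrt l : ℂ) ^ 2 = l := by exact_mod_cast Real.sq_sqrt hl.le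
  have hs0 : (Real.sqrt l : ℂ) ≠ 0 := by exact_mod_cast (Real.sqrt_pos.2 hl).ne'
  have hl0 : 0 ≤ δ := (norm_nonneg _).trans (hδ x hx)
  have hgi : IntervalIntegrable g volume 0 l := by
    refine ContinuousOn.intervalIntegrable ?_
    rw [uIcc_of_le hl.le]
    exact hg.continuousOn
  have hinner : ⟪stiffMode l τ, u⟫_ℂ =
      conj (xi l τ) / Real.sqrt l * ∫ y in (0 : ℝ)..l, g y := by
    rw [intervalIntegral.integral_of_le hl.le, ← restrict_Ioo_eq_restrict_Ioc,
      ← integral_const_mul, L2.inner_def]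
    refine integral_congr_ae ?_
    filter_upwards [hu, coeFn_stiffMode l τ] with y h1 h2
    have h3 : conj (Complex.exp (-(Complex.I * τ) * y)) = Complex.exp (Complex.I * τ * y) := by
      rw [← Complex.exp_conj]
      simp
    rw [h1, h2, RCLike.inner_apply, stiffModeFun_eq, map_div₀, map_mul, h3, Complex.conj_ofReal,
      hgdef]
    ring
  have hmean : Complex.exp (Complex.I * τ * x) *
      (f x - ⟪stiffMode l τ, u⟫_ℂ * stiffModeFun l τ x) =
        (1 / l : ℂ) * ∫ y in (0 : ℝ)..l, (g x - g y) := by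
    have h1 : Complex.exp (Complex.I * τ * x) * Complex.exp (-(Complex.I * τ) * x) = 1 := by
      rw [← Complex.exp_add]
      simp
    have h2 := conj_xi_mul_xi l τ
    rw [intervalIntegral.integral_sub intervalIntegrable_const hgi,
      intervalIntegral.integral_const, hinner, stiffModeFun_eq, sub_zero, Complex.real_smul,
      ← hs]
    generalize Complex.exp (-(Complex.I * τ) * x) = e at h1 ⊢
    field_simp
    simp only [hgdef]
    linear_combination (-(∫ y in (0 : ℝ)..l, Complex.exp (Complex.I * τ * y) * f y)) *
      (h1 * conj (xi l τ) * xi l τ + h2)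
  have hosc (y : ℝ) (hy : y ∈ Icc (0 : ℝ) l) : ‖g x - g y‖ ≤ l * δ := by
    rw [hg.sub_eq_integral hy hx]
    have hb : ∀ t ∈ uIoc y x, ‖Complex.exp (Complex.I * τ * t) * covDeriv τ f f₁ t‖ ≤ δ := by
      intro t ht
      rw [norm_mul, norm_exp_gauge, one_mul]
      exact hδ t (uIcc_subset_Icc hy hx (uIoc_subset_uIcc ht))
    refine (intervalIntegral.norm_integral_le_of_norm_le_const hb).trans ?_
    rw [mul_comm]
    gcongr
    rw [abs_le]
    constructor <;> linarith [hx.1, hx.2, hy.1, hy.2]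
  have hb := intervalIntegral.norm_integral_le_of_norm_le_const (a := 0) (b := l)
    (f := fun y => g x - g y) (C := l * δ) fun y hy => by
      rw [uIoc_of_le hl.le] at hy
      exact hosc y (Ioc_subset_Icc_self hy)
  have hn := congrArg norm hmean
  rw [norm_mul, norm_exp_gauge, one_mul, norm_mul, norm_div, norm_one, Complex.norm_real,
    Real.norm_of_nonneg hl.le] at hn
  rw [hn]
  rw [sub_zero, abs_of_pos hl] at hb
  calc 1 / l * ‖∫ y in (0 : ℝ)..l, (g x - g y)‖ ≤ 1 / l * (l * δ * l) := by gcongr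
    _ = l * δ := by field_simp

end Bounds

/-! ### The resolvent estimate -/

section ResolventEstimate

variable {l₁ l₂ a₁ ε τ : ℝ}

theorem norm_add_norm_le_of_isFormalAdjoint {E : Type*} [NormedAddCommGroup E]
    [InnerProductSpace ℂ E] {A : E →ₗ.[ℂ] E} (hA : A.IsFormalAdjoint A) {M σ : ℝ} {z : ℂ}
    (hσ : 0 < σ) (hz : σ ≤ |z.im|) (hM : ‖z‖ ≤ M) (u : A.domain) :
    ‖(u : E)‖ + ‖A u‖ ≤ (1 + (1 + M) / σ) * ‖A u - z • (u : E)‖ := by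
  have h1 := abs_im_mul_norm_le_of_isFormalAdjoint hA z u
  have h2 : ‖(u : E)‖ ≤ ‖A u - z • (u : E)‖ / σ := by
    rw [le_div_iff₀ hσ, mul_comm]
    exact (mul_le_mul_of_nonneg_right hz (norm_nonneg _)).trans h1
  have h3 : ‖A u‖ ≤ ‖A u - z • (u : E)‖ + M * ‖(u : E)‖ := by
    have := norm_add_le (A u - z • (u : E)) (z • (u : E))
    rw [sub_add_cancel, norm_smul] at this
    exact this.trans (by gcongr)
  have hM0 : 0 ≤ M := (norm_nonneg z).trans hM
  calc ‖(u : E)‖ + ‖A u‖ ≤ ‖A u - z • (u : E)‖ + (1 + M) * ‖(u : E)‖ := by linarith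
    _ ≤ ‖A u - z • (u : E)‖ + (1 + M) * (‖A u - z • (u : E)‖ / σ) := by gcongr
    _ = _ := by ring

theorem stiffModeFun_zero (l₁ τ : ℝ) : stiffModeFun l₁ τ 0 = xi l₁ τ / Real.sqrt l₁ := by
  simp [stiffModeFun_eq]

theorem stiffModeFun_right (l₁ τ : ℝ) : stiffModeFun l₁ τ l₁ = 1 / Real.sqrt l₁ := by
  simp [stiffModeFun]

/-- The defect in intertwining `A_ε` and `𝒜_hom` by `Ψ`. All boundary terms cancel except those
which measure how far the stiff component is, at the two vertices, from its projection onto the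
stiff mode. -/
theorem inner_Psi_sub_inner_Psi (hl₁ : 0 < l₁) (hl₂ : 0 < l₂) {w w' : H l₁ l₂} {q q' : Hhom l₂}
    {s s₁ t t₁ f f₁ : ℝ → ℂ} (hs : EdgeRel l₂ τ 1 w.fst w'.fst s s₁)
    (ht : EdgeRel l₁ τ (a₁ ^ 2 / ε ^ 2) w.snd w'.snd t t₁) (h1 : s 0 = t l₁) (h2 : s l₂ = t 0)
    (h3 : covDeriv τ s s₁ 0 - ((a₁ ^ 2 / ε ^ 2 : ℝ) : ℂ) * covDeriv τ t t₁ l₁ = 0)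
    (h4 : -covDeriv τ s s₁ l₂ + ((a₁ ^ 2 / ε ^ 2 : ℝ) : ℂ) * covDeriv τ t t₁ 0 = 0)
    (hf : EdgeRel l₂ τ 1 q.fst q'.fst f f₁) (k1 : f 0 = conj (xi l₁ τ) * f l₂)
    (k2 : f 0 = q.snd / (Real.sqrt l₁ : ℂ))
    (k3 : q'.snd = -(1 / (Real.sqrt l₁ : ℂ)) *
      (covDeriv τ f f₁ 0 - conj (xi l₁ τ) * covDeriv τ f f₁ l₂)) :
    ⟪Psi l₁ l₂ τ w, q'⟫_ℂ - ⟪Psi l₁ l₂ τ w', q⟫_ℂ =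
      conj (t l₁ - ⟪stiffMode l₁ τ, w.snd⟫_ℂ * stiffModeFun l₁ τ l₁) * covDeriv τ f f₁ 0 -
        conj (t 0 - ⟪stiffMode l₁ τ, w.snd⟫_ℂ * stiffModeFun l₁ τ 0) * covDeriv τ f f₁ l₂ := by
  have hsq : (Real.sqrt l₁ : ℂ) ≠ 0 := by exact_mod_cast (Real.sqrt_pos.2 hl₁).ne'
  have e1 := hs.green hl₂.le hf
  have e2 := ht.green hl₁.le (edgeRel_stiffMode l₁ τ (a₁ ^ 2 / ε ^ 2))
  have k1' : f l₂ = xi l₁ τ * f 0 := by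
    linear_combination (-f l₂) * conj_xi_mul_xi l₁ τ - xi l₁ τ * k1
  have hq : q.snd = Real.sqrt l₁ * f 0 := by rw [k2]; field_simp
  have c3 := congrArg conj h3
  have c4 := congrArg conj h4
  simp only [map_sub, map_add, map_neg, map_mul, Complex.conj_ofReal, map_zero] at c3 c4
  simp only [bdryForm, covDeriv_stiffModeFun, stiffModeFun_zero, stiffModeFun_right, mul_zero,
    sub_zero, inner_zero_right, zero_sub] at e2
  simp only [bdryForm, h1, h2, k1', Complex.ofReal_one, one_mul] at e1
  rw [prod_inner_eq, prod_inner_eq, Psi_fst, Psi_fst, Psi_snd, Psi_snd, RCLike.inner_apply,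
    RCLike.inner_apply, inner_conj_symm w'.snd, k3, hq, stiffModeFun_zero, stiffModeFun_right]
  have e2' : (Real.sqrt l₁ : ℂ) * ⟪w'.snd, stiffMode l₁ τ⟫_ℂ =
      -(((a₁ ^ 2 / ε ^ 2 : ℝ) : ℂ) * (conj (covDeriv τ t t₁ l₁) -
        conj (covDeriv τ t t₁ 0) * xi l₁ τ)) := by
    have h0 : (Real.sqrt l₁ : ℂ) * (1 / Real.sqrt l₁) = 1 := mul_one_div_cancel hsq
    linear_combination (-(Real.sqrt l₁ : ℂ)) * e2 - ((a₁ ^ 2 / ε ^ 2 : ℝ) : ℂ) *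
      (conj (covDeriv τ t t₁ l₁) - conj (covDeriv τ t t₁ 0) * xi l₁ τ) * h0
  simp only [map_sub, map_mul, map_div₀, map_one, Complex.conj_ofReal]
  linear_combination e1 - f 0 * e2' - f 0 * c3 - f 0 * xi l₁ τ * c4

/-- The stiff component of a function in the domain of `A_ε` is `O(ε²)`-close to its projection
onto the stiff mode, because `(a₁²/ε²) ∂t` is bounded: at a vertex it equals the boundary value of
`∂s`, and its variation along the edge is controlled by the differential equation. -/
theorem norm_sub_stiffMode_le_of_mem_fibreGraph (hl₁ : 0 < l₁) (ha₁ : 0 < a₁) (hε : 0 < ε)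
    {w w' : H l₁ l₂} {s s₁ t t₁ : ℝ → ℂ}
    (ht : EdgeRel l₁ τ (a₁ ^ 2 / ε ^ 2) w.snd w'.snd t t₁)
    (h3 : covDeriv τ s s₁ 0 - ((a₁ ^ 2 / ε ^ 2 : ℝ) : ℂ) * covDeriv τ t t₁ l₁ = 0)
    {B B' : ℝ} (hB : ‖covDeriv τ s s₁ 0‖ ≤ B) (hB' : ‖w'.snd‖ ≤ B') {x : ℝ}
    (hx : x ∈ Icc (0 : ℝ) l₁) :
    ‖t x - ⟪stiffMode l₁ τ, w.snd⟫_ℂ * stiffModeFun l₁ τ x‖ ≤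
      l₁ * (ε ^ 2 / a₁ ^ 2 * (B + Real.sqrt l₁ * B')) := by
  have hκ : 0 < a₁ ^ 2 / ε ^ 2 := by positivity
  refine ht.norm_sub_stiffMode_le hl₁ (fun y hy => ?_) hx
  have h := ht.norm_covDeriv_le hl₁.le hκ hy
  have h0 : a₁ ^ 2 / ε ^ 2 * ‖covDeriv τ t t₁ l₁‖ = ‖covDeriv τ s s₁ 0‖ := by
    rw [sub_eq_zero.1 h3, norm_mul, Complex.norm_real, Real.norm_of_nonneg hκ.le]
  rw [h0] at h
  have h5 : a₁ ^ 2 / ε ^ 2 * ‖covDeriv τ t t₁ y‖ ≤ B + Real.sqrt l₁ * B' :=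
    h.trans (by gcongr)
  calc ‖covDeriv τ t t₁ y‖ = ε ^ 2 / a₁ ^ 2 * (a₁ ^ 2 / ε ^ 2 * ‖covDeriv τ t t₁ y‖) := by
        field_simp
    _ ≤ _ := by gcongr

/-- The distance to a vector of the form `Ψ* p` splits into the part orthogonal to the range of
`Ψ*` and a part in the homogenised space. -/
theorem norm_sub_adjoint_Psi_le (hl₁ : 0 < l₁) (w : H l₁ l₂) (p : Hhom l₂) :
    ‖w - ContinuousLinearMap.adjoint (Psi l₁ l₂ τ) p‖ ≤
      ‖w.snd - ⟪stiffMode l₁ τ, w.snd⟫_ℂ • stiffMode l₁ τ‖ + ‖Psi l₁ l₂ τ w - p‖ := by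
  have h : w - ContinuousLinearMap.adjoint (Psi l₁ l₂ τ) p =
      WithLp.toLp 2 (0, w.snd - ⟪stiffMode l₁ τ, w.snd⟫_ℂ • stiffMode l₁ τ) +
        ContinuousLinearMap.adjoint (Psi l₁ l₂ τ) (Psi l₁ l₂ τ w - p) := by
    rw [map_sub, adjoint_Psi_apply (Psi l₁ l₂ τ w), add_sub, sub_left_inj]
    exact WithLp.ofLp_injective 2 (Prod.ext (zero_add _).symm (sub_add_cancel _ _).symm)
  rw [h]
  refine (norm_add_le _ _).trans_eq ?_
  rw [norm_adjoint_Psi_apply hl₁, WithLp.norm_toLp_snd]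

/-- The resolvent estimate on vectors, with a constant that depends on the bounds `M` and `σ` for
the spectral parameter, but not on `ε`, `τ` and `z`. -/
theorem exists_norm_resolvent_sub_le (hl₁ : 0 < l₁) (hl₂ : 0 < l₂) (ha₁ : 0 < a₁) {M σ : ℝ}
    (hM : 0 ≤ M) (hσ : 0 < σ) :
    ∃ C : ℝ, 0 ≤ C ∧ ∀ ε : ℝ, 0 < ε → ∀ (τ : ℝ) (z : ℂ), ‖z‖ ≤ M → σ ≤ |z.im| →
      ∀ (R : H l₁ l₂ →L[ℂ] H l₁ l₂) (Rhom : Hhom l₂ →L[ℂ] Hhom l₂),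
        IsResolventAt (fibreOp l₁ l₂ a₁ ε τ) z R → IsResolventAt (homOp l₁ l₂ τ) z Rhom →
          ∀ F, ‖R F - ContinuousLinearMap.adjoint (Psi l₁ l₂ τ) (Rhom (Psi l₁ l₂ τ F))‖ ≤
            C * ε ^ 2 * ‖F‖ := by
  obtain ⟨B, hB, hbd⟩ := exists_norm_covDeriv_le hl₂
  set D := 1 + (1 + M) / σ with hD
  have hD0 : 0 ≤ D := by positivity
  have hr := Real.sqrt_nonneg l₁
  refine ⟨(Real.sqrt l₁ + 2 * (B * D)) * (l₁ * ((B * D + Real.sqrt l₁ * D) / a₁ ^ 2)),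
    by positivity, fun ε hε τ z hzM hz R Rhom hR hRh F => ?_⟩
  have hz0 : z.im ≠ 0 := abs_pos.1 (hσ.trans_le hz)
  obtain ⟨w, hw, hwF⟩ := hR.1 F
  obtain ⟨p, hp, hpF⟩ := hRh.1 (Psi l₁ l₂ τ F)
  rw [← hw, ← hp]
  obtain ⟨s, s₁, t, t₁, hs, ht, h1, h2, h3, h4⟩ := fibreOp_mem_graph hl₁ hl₂ w
  simp only at hs ht
  have hwn := norm_add_norm_le_of_isFormalAdjoint (fibreOp_isFormalAdjoint hl₁ hl₂) hσ hz hzM w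
  rw [hwF, ← hD] at hwn
  set Aw := fibreOp l₁ l₂ a₁ ε τ w with hAw
  set W : H l₁ l₂ := (w : H l₁ l₂) with hW
  set δ := l₁ * (ε ^ 2 / a₁ ^ 2 * (B * (D * ‖F‖) + Real.sqrt l₁ * (D * ‖F‖))) with hδ
  have hδ0 : 0 ≤ δ := by positivity
  have hosc : ∀ x ∈ Icc (0 : ℝ) l₁,
      ‖t x - ⟪stiffMode l₁ τ, W.snd⟫_ℂ * stiffModeFun l₁ τ x‖ ≤ δ := fun x hx => by
    refine norm_sub_stiffMode_le_of_mem_fibreGraph hl₁ ha₁ hε ht h3 ?_ ?_ hx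
    · refine (hbd τ _ _ _ _ hs).1.trans ?_
      gcongr
      exact (add_le_add (WithLp.norm_fst_le _ _) (WithLp.norm_fst_le _ _)).trans hwn
    · exact (WithLp.norm_snd_le _ _).trans ((le_add_of_nonneg_left (norm_nonneg _)).trans hwn)
  -- The part of the solution orthogonal to the range of `Ψ*`.
  have hperp : ‖W.snd - ⟪stiffMode l₁ τ, W.snd⟫_ℂ • stiffMode l₁ τ‖ ≤ Real.sqrt l₁ * δ := by
    obtain ⟨-, -, hu, -⟩ := ht
    refine norm_le_of_ae_norm_le hl₁.le hδ0 ?_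
    filter_upwards [Lp.coeFn_sub W.snd (⟪stiffMode l₁ τ, W.snd⟫_ℂ • stiffMode l₁ τ),
      Lp.coeFn_smul ⟪stiffMode l₁ τ, W.snd⟫_ℂ (stiffMode l₁ τ), hu, coeFn_stiffMode l₁ τ,
      ae_restrict_mem measurableSet_Ioo] with x e1 e2 e3 e4 hx
    rw [e1, Pi.sub_apply, e2, Pi.smul_apply, e3, e4, smul_eq_mul]
    exact hosc x (Ioo_subset_Icc_self hx)
  -- The remaining part `y = Ψ w - p` is tested with the solution of the adjoint problem.
  set y : Hhom l₂ := Psi l₁ l₂ τ W - p with hy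
  have hyn : ‖y‖ ≤ 2 * (B * D) * δ := by
    have hzc : (conj z).im ≠ 0 := by simpa using hz0
    obtain ⟨q, hq⟩ := homOp_sub_smul_surjective (τ := τ) hl₁ hl₂ hzc y
    obtain ⟨f, f₁, hf, k1, k2, k3⟩ := homOp_mem_graph hl₂ q
    simp only at hf k2 k3
    have hqn := norm_add_norm_le_of_isFormalAdjoint (homOp_isFormalAdjoint hl₁ hl₂) hσ
      (z := conj z) (M := M) (by simpa using hz) (by simpa using hzM) q
    rw [hq, ← hD] at hqn
    have hsymm : ⟪homOp l₁ l₂ τ p, (q : Hhom l₂)⟫_ℂ = ⟪(p : Hhom l₂), homOp l₁ l₂ τ q⟫_ℂ :=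
      homOp_isFormalAdjoint hl₁ hl₂ p q
    have hid : ⟪y, y⟫_ℂ =
        ⟪Psi l₁ l₂ τ W, homOp l₁ l₂ τ q⟫_ℂ - ⟪Psi l₁ l₂ τ Aw, (q : Hhom l₂)⟫_ℂ := by
      have h5 : homOp l₁ l₂ τ p - z • (p : Hhom l₂) = Psi l₁ l₂ τ Aw - z • Psi l₁ l₂ τ W := by
        rw [hpF, ← hwF, map_sub, map_smul]
      have h6 := congrArg (fun x => ⟪x, (q : Hhom l₂)⟫_ℂ) h5
      simp only [inner_sub_left, inner_smul_left] at h6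
      nth_rw 2 [← hq]
      rw [hy]
      simp only [inner_sub_left, inner_sub_right, inner_smul_right]
      linear_combination -h6 + hsymm
    rw [inner_Psi_sub_inner_Psi hl₁ hl₂ hs ht h1 h2 h3 h4 hf k1 k2 k3] at hid
    have hgn : ‖(q : Hhom l₂).fst‖ + ‖(homOp l₁ l₂ τ q).fst‖ ≤ D * ‖y‖ :=
      (add_le_add (WithLp.norm_fst_le _ _) (WithLp.norm_fst_le _ _)).trans hqn
    obtain ⟨b0, b1⟩ := hbd τ _ _ _ _ hf
    have b0' := b0.trans (mul_le_mul_of_nonneg_left hgn hB)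
    have b1' := b1.trans (mul_le_mul_of_nonneg_left hgn hB)
    have hn : ‖y‖ * ‖y‖ ≤ δ * (B * (D * ‖y‖)) + δ * (B * (D * ‖y‖)) := by
      have h7 : ‖⟪y, y⟫_ℂ‖ = ‖y‖ * ‖y‖ := by
        rw [inner_self_eq_norm_sq_to_K, norm_pow, sq]
        simp
      rw [← h7, hid]
      refine (norm_sub_le _ _).trans ?_
      rw [norm_mul, norm_mul, RCLike.norm_conj, RCLike.norm_conj]
      gcongr
      · exact hosc l₁ ⟨hl₁.le, le_rfl⟩
      · exact_mod_cast hosc 0 ⟨le_rfl, hl₁.le⟩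
    rcases eq_or_lt_of_le (norm_nonneg y) with h0 | h0
    · rw [← h0]
      positivity
    · refine le_of_mul_le_mul_right ?_ h0
      linarith
  refine (norm_sub_adjoint_Psi_le hl₁ W p).trans ((add_le_add hperp hyn).trans_eq ?_)
  rw [hδ]
  ring

end ResolventEstimate

end HighContrastChain

theorem mainTheorem2 (l₁ l₂ a₁ : ℝ) (hl₁ : 0 < l₁) (hl₂ : 0 < l₂) (hl : l₁ + l₂ = 1)
    (ha₁ : 0 < a₁) :
    (∀ ε : ℝ, 0 < ε → ∀ τ ∈ Set.Ico (-Real.pi) Real.pi,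
      IsSelfAdjoint (HighContrastChain.fibreOp l₁ l₂ a₁ ε τ)) ∧
    (∀ τ ∈ Set.Ico (-Real.pi) Real.pi, IsSelfAdjoint (HighContrastChain.homOp l₁ l₂ τ)) ∧
    (∀ τ ∈ Set.Ico (-Real.pi) Real.pi,
      HighContrastChain.Psi l₁ l₂ τ ∘L
        ContinuousLinearMap.adjoint (HighContrastChain.Psi l₁ l₂ τ) =
          ContinuousLinearMap.id ℂ (HighContrastChain.Hhom l₂)) ∧
    ∀ (K : Set ℂ) (σ : ℝ), IsCompact K → 0 < σ →
      ∃ C : ℝ, ∀ ε : ℝ, 0 < ε → ∀ τ ∈ Set.Ico (-Real.pi) Real.pi, ∀ z ∈ K, σ ≤ |z.im| →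
        ∃ (R : HighContrastChain.H l₁ l₂ →L[ℂ] HighContrastChain.H l₁ l₂)
          (Rhom : HighContrastChain.Hhom l₂ →L[ℂ] HighContrastChain.Hhom l₂),
          HighContrastChain.IsResolventAt (HighContrastChain.fibreOp l₁ l₂ a₁ ε τ) z R ∧
          HighContrastChain.IsResolventAt (HighContrastChain.homOp l₁ l₂ τ) z Rhom ∧
          ‖R - ContinuousLinearMap.adjoint (HighContrastChain.Psi l₁ l₂ τ) ∘L Rhom ∘L
            HighContrastChain.Psi l₁ l₂ τ‖ ≤ C * ε ^ 2 := by
  refine ⟨fun ε hε τ _ => HighContrastChain.fibreOp_isSelfAdjoint hl₁ hl₂ ha₁ hε,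
    fun τ _ => HighContrastChain.homOp_isSelfAdjoint hl₁ hl₂,
    fun τ _ => HighContrastChain.Psi_comp_adjoint hl₁, fun K σ hK hσ => ?_⟩
  obtain ⟨M, hM, hKM⟩ := hK.isBounded.exists_pos_norm_le
  obtain ⟨C, hC, h⟩ :=
    HighContrastChain.exists_norm_resolvent_sub_le hl₁ hl₂ ha₁ hM.le hσ
  refine ⟨C, fun ε hε τ _ z hz hzσ => ?_⟩
  have hz0 : z.im ≠ 0 := abs_pos.1 (hσ.trans_le hzσ)
  obtain ⟨R, hR⟩ := HighContrastChain.exists_isResolventAt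
    (HighContrastChain.fibreOp_isFormalAdjoint (a₁ := a₁) (ε := ε) (τ := τ) hl₁ hl₂) hz0
    (HighContrastChain.fibreOp_sub_smul_surjective hl₁ hl₂ ha₁ hε hz0)
  obtain ⟨Rhom, hRhom⟩ := HighContrastChain.exists_isResolventAt
    (HighContrastChain.homOp_isFormalAdjoint (τ := τ) hl₁ hl₂) hz0
    (HighContrastChain.homOp_sub_smul_surjective hl₁ hl₂ hz0)
  refine ⟨R, Rhom, hR, hRhom, ContinuousLinearMap.opNorm_le_bound _ (by positivity) fun F => ?_⟩
  exact h ε hε τ z (hKM z hz) hzσ R Rhom hR hRhom F
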